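/- Let $N\ge 0$ and $n\ge 1$ be integers, and let $E=\mathbf R^N\times\mathbf R\to\mathbf R^N$ be the trivial line bundle, with coordinates $x^i,u_J$ on $J^\infty E$ ($1\le i\le N$, $J\in\mathbf Z_{\ge0}^N$). Let $\mathrm{Loc}(E)$ be the space of local functions, i.e. pullbacks to $J^\infty E$ of smooth functions on some $J^kE$, and let $\frac d{dx^i}=\frac\partial{\partial x^i}+\sum_J u_{iJ}\frac\partial{\partial u_J}$ be the total derivatives, where $iJ$ is $J$ with its $i$-th entry raised by one. For $I\in\mathbf Z_{\ge 0}^N$ and a finitely supported family $\alpha$ of non-negative integers indexed by the multi-indices $J$, put $\left(\frac d{d\mathbf x}\right)^I=\prod_i\left(\frac d{dx^i}\right)^{I^i}$, $|I|=\sum_i I^i$, $\left(\frac\partial{\partial\mathbf u}\right)^{\alpha}=\prod_J\left(\frac{\partial}{\partial u_J}\right)^{\alpha(J)}$, and $\deg_f(\alpha)=\max\{|J|:\alpha(J)\ne0\}$ (which is $0$ if $\alpha=0$). An *$n$-multilinear LDO* (local differential operator) is an $n$-linear map $A:\mathrm{Loc}(E)^{\otimes n}\to\mathrm{Loc}(E)$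 of the form $$A(f_1,\dots,f_n)=\sum p_{I_1,\dots,I_n,\alpha_1,\dots,\alpha_n}\prod_{j=1}^n\left(\tfrac d{d\mathbf x}\right)^{I_j}\left(\tfrac\partial{\partial\mathbf u}\right)^{\alpha_j}f_j,\qquad p_{I_1,\dots,\alpha_n}\in\mathrm{Loc}(E),$$ where for each $m$ only finitely many nonzero $p_{I_1,\dots,\alpha_n}$ have $\sum_j\deg_f(\alpha_j)\le m$. Write $\frac d{dx^i_j}$ and $\frac\partial{\partial\mathbf u_j}$ for $\frac d{dx^i}$ and $\frac\partial{\partial\mathbf u}$ applied to the $j$-th argument, $A\frac{d}{dx^i_j}$ for $A$ precomposed with $\frac d{dx^i_j}$, and put $\frac d{dy_1^i}=\sum_{j=1}^n\frac d{dx^i_j}$ and $\frac d{dy^i_j}=\frac d{dx^i_j}$ for $j\ge2$. Every LDO has a unique polarized form $$A=\sum q_{I_1,\dots,I_n;\alpha_1,\dots,\alpha_n}\left(\tfrac d{d\mathbf y_1}\right)^{I_1}\cdots\left(\tfrac d{d\mathbf y_n}\right)^{I_n}\left(\tfrac\partial{\partial\mathbf u_1}\right)^{\alpha_1}\cdots\left(\tfrac\partial{\partial\mathbf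 u_n}\right)^{\alpha_n}$$ with coefficients in $\mathrm{Loc}(E)$ satisfying the same finiteness condition, and its *characteristic* is the LDO $$\chi(A)=\sum(-1)^{|I_1|}\left(\left(\tfrac d{d\mathbf x}\right)^{I_1}q_{I_1,\dots,I_n;\alpha_1,\dots,\alpha_n}\right)\left(\tfrac d{d\mathbf y_2}\right)^{I_2}\cdots\left(\tfrac d{d\mathbf y_n}\right)^{I_n}\left(\tfrac\partial{\partial\mathbf u_1}\right)^{\alpha_1}\cdots\left(\tfrac\partial{\partial\mathbf u_n}\right)^{\alpha_n}.$$ Let $\Omega_s=\Omega^{N-s,0}(J^\infty E)$ be the horizontal $(N-s)$-forms with coefficients in $\mathrm{Loc}(E)$ (zero unless $0\le s\le N$), a chain complex under $d_H\omega=\sum_i dx^i\wedge\frac d{dx^i}\omega$. Put on $(\Omega_*)^{\otimes n}$ the differential $$d_H^{\otimes n}(\omega_1\otimes\cdots\otimes\omega_n)=\sum_j(-1)^{s_1+\cdots+s_{j-1}}\,\omega_1\otimes\cdots\otimes d_H\omega_j\otimes\cdots\otimes\omega_n,\qquad \omega_l\in\Omega_{s_l},$$ and identify $\Omega_0$ with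 $\mathrm{Loc}(E)$ by $g\mapsto g\,dx^1\wedge\cdots\wedge dx^N$. A *lift* of an $n$-multilinear LDO $A:[(\Omega_*)^{\otimes n}]_0\to\Omega_0$ is a sequence of linear maps $f_s:[(\Omega_*)^{\otimes n}]_s\to\Omega_s$, $s\ge0$, whose matrix coefficients with respect to the bases $dx^{i_1}\wedge\cdots\wedge dx^{i_k}$ ($i_1<\cdots<i_k$) are $n$-multilinear LDOs, such that $f_0=A$ and $d_Hf_s=f_{s-1}d_H^{\otimes n}$ for all $s\ge1$. Let $A:[(\Omega_*)^{\otimes n}]_0\to\Omega_0$ be an $n$-multilinear LDO. Then $A$ has a lift if and only if $$\chi\left(A\,\tfrac d{dx^i_j}\right)=0\quad\text{for all }1\le i\le N,\ 1\le j\le n.$$ Moreover, if $\chi(A)=0$, then $A$ has a lift with $f_s=0$ for all $s\ge2$. -/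

import Mathlib

open scoped ContDiff

noncomputable section

namespace HorizontalLDO

/-! ### Local functions on the infinite jet bundle of the trivial line bundle over `ℝ^N` -/

/-- Multi-indices `J = (j_1, …, j_N)`. -/
abbrev MIdx (N : ℕ) : Type := Fin N → ℕ

/-- The order `|J| = j_1 + ⋯ + j_N`. -/
def order {N : ℕ} (J : MIdx N) : ℕ := ∑ i, J i

/-- The multi-index `iJ`, that is `J` with its `i`-th entry raised by one. -/
def raise {N : ℕ} (i : Fin N) (J : MIdx N) : MIdx N := J + Pi.single i 1

/-- Points of the infinite jet bundle, in the coordinates `(x^i, u_J)`. -/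
abbrev Jet (N : ℕ) : Type := (Fin N → ℝ) × (MIdx N → ℝ)

/-- The finite set of multi-indices of order at most `k`. -/
def idxLE (N k : ℕ) : Finset (MIdx N) :=
  (Fintype.piFinset fun _ => Finset.range (k + 1)).filter fun J => order J ≤ k

theorem mem_idxLE {N k : ℕ} {J : MIdx N} : J ∈ idxLE N k ↔ order J ≤ k := by
  simp only [idxLE, Finset.mem_filter, Fintype.mem_piFinset, Finset.mem_range,
    and_iff_right_iff_imp]
  intro h i
  have := Finset.single_le_sum (f := J) (fun _ _ => Nat.zero_le _) (Finset.mem_univ i)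
  unfold order at h
  omega

/-- The `k`-jet bundle `J^k E`, in coordinates. -/
abbrev FinJet (N k : ℕ) : Type := (Fin N → ℝ) × (idxLE N k → ℝ)

/-- The projection of the infinite jet bundle onto `J^k E`. -/
def toFinJet {N : ℕ} (k : ℕ) (p : Jet N) : FinJet N k := (p.1, fun J => p.2 J)

/-- A local function is the pullback of a smooth function on some `J^k E`. -/
def IsLocal {N : ℕ} (f : Jet N → ℝ) : Prop :=
  ∃ (k : ℕ) (g : FinJet N k → ℝ), ContDiff ℝ ∞ g ∧ f = g ∘ toFinJet k

/-- The projection `J^l E → J^k E` for `k ≤ l`. -/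
def finProj {N k l : ℕ} (h : k ≤ l) (p : FinJet N l) : FinJet N k :=
  (p.1, fun J => p.2 ⟨J.1, mem_idxLE.2 ((mem_idxLE.1 J.2).trans h)⟩)

theorem contDiff_finProj {N k l : ℕ} (h : k ≤ l) :
    ContDiff ℝ ∞ (finProj h : FinJet N l → FinJet N k) := by
  unfold finProj
  fun_prop

theorem IsLocal.lift {N : ℕ} {k l : ℕ} (h : k ≤ l) {g : FinJet N k → ℝ} (hg : ContDiff ℝ ∞ g) :
    ∃ g' : FinJet N l → ℝ, ContDiff ℝ ∞ g' ∧ g ∘ toFinJet k = g' ∘ toFinJet l :=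
  ⟨g ∘ finProj h, hg.comp (contDiff_finProj h), rfl⟩

theorem IsLocal.common {N : ℕ} {f g : Jet N → ℝ} (hf : IsLocal f) (hg : IsLocal g) :
    ∃ (k : ℕ) (f' g' : FinJet N k → ℝ), ContDiff ℝ ∞ f' ∧ ContDiff ℝ ∞ g' ∧
      f = f' ∘ toFinJet k ∧ g = g' ∘ toFinJet k := by
  obtain ⟨k, f', hf', rfl⟩ := hf
  obtain ⟨l, g', hg', rfl⟩ := hg
  obtain ⟨f'', h1, h2⟩ := IsLocal.lift (le_max_left k l) hf'
  obtain ⟨g'', h3, h4⟩ := IsLocal.lift (le_max_right k l) hg'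
  exact ⟨_, f'', g'', h1, h3, h2, h4⟩

/-- The algebra `Loc(E)` of local functions. -/
def Loc (N : ℕ) : Subalgebra ℝ (Jet N → ℝ) where
  carrier := {f | IsLocal f}
  mul_mem' := by
    intro f g hf hg
    obtain ⟨k, f', g', h1, h2, rfl, rfl⟩ := IsLocal.common hf hg
    exact ⟨k, f' * g', h1.mul h2, rfl⟩
  add_mem' := by
    intro f g hf hg
    obtain ⟨k, f', g', h1, h2, rfl, rfl⟩ := IsLocal.common hf hg
    exact ⟨k, f' + g', h1.add h2, rfl⟩
  algebraMap_mem' := fun r => ⟨0, fun _ => r, contDiff_const, rfl⟩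

/-! ### Partial and total derivatives -/

/-- The partial derivative `∂f/∂x^i`. -/
def pdX {N : ℕ} (i : Fin N) (f : Jet N → ℝ) (p : Jet N) : ℝ :=
  deriv (fun t => f (Function.update p.1 i t, p.2)) (p.1 i)

/-- The partial derivative `∂f/∂u_J`. -/
def pdU {N : ℕ} (J : MIdx N) (f : Jet N → ℝ) (p : Jet N) : ℝ :=
  deriv (fun t => f (p.1, Function.update p.2 J t)) (p.2 J)

/-- The total derivative `df/dx^i = ∂f/∂x^i + ∑_J u_{iJ} ∂f/∂u_J`; the sum is finite when `f` is
a local function. -/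
def totD {N : ℕ} (i : Fin N) (f : Jet N → ℝ) (p : Jet N) : ℝ :=
  pdX i f p + ∑ᶠ J : MIdx N, p.2 (raise i J) * pdU J f p

theorem hasDerivAt_lineX {N k : ℕ} {g : FinJet N k → ℝ} (hg : ContDiff ℝ ∞ g) (i : Fin N)
    (p : Jet N) :
    HasDerivAt (fun t => (g ∘ toFinJet k) (Function.update p.1 i t, p.2))
      (fderiv ℝ g (toFinJet k p) (Pi.single i 1, 0)) (p.1 i) := by
  have h1 : HasDerivAt (fun t => ((Function.update p.1 i t, fun J : idxLE N k => p.2 J) :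
      FinJet N k)) (Pi.single i 1, 0) (p.1 i) :=
    (hasDerivAt_update p.1 i (p.1 i)).prodMk (hasDerivAt_const _ _)
  have h2 : HasFDerivAt g (fderiv ℝ g (toFinJet k p))
      ((Function.update p.1 i (p.1 i), fun J : idxLE N k => p.2 J) : FinJet N k) := by
    rw [Function.update_eq_self]
    exact ((hg.differentiable (by simp)) _).hasFDerivAt
  exact h2.comp_hasDerivAt (p.1 i) h1

theorem hasDerivAt_lineU {N k : ℕ} {g : FinJet N k → ℝ} (hg : ContDiff ℝ ∞ g)
    {J : MIdx N} (hJ : J ∈ idxLE N k) (p : Jet N) :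
    HasDerivAt (fun t => (g ∘ toFinJet k) (p.1, Function.update p.2 J t))
      (fderiv ℝ g (toFinJet k p) (0, Pi.single ⟨J, hJ⟩ 1)) (p.2 J) := by
  have e : ∀ t, (fun K : idxLE N k => Function.update p.2 J t K) =
      Function.update (fun K : idxLE N k => p.2 K) ⟨J, hJ⟩ t := by
    intro t
    ext K
    by_cases h : K = ⟨J, hJ⟩
    · subst h; simp
    · have : (K : MIdx N) ≠ J := fun h' => h (Subtype.ext h')
      simp [h, this]
  have h1 : HasDerivAt (fun t => ((p.1, fun K : idxLE N k => Function.update p.2 J t K) :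
      FinJet N k)) (0, Pi.single ⟨J, hJ⟩ 1) (p.2 J) := by
    simp only [e]
    exact (hasDerivAt_const _ _).prodMk (hasDerivAt_update _ _ _)
  have h2 : HasFDerivAt g (fderiv ℝ g (toFinJet k p))
      ((p.1, fun K : idxLE N k => Function.update p.2 J (p.2 J) K) : FinJet N k) := by
    rw [Function.update_eq_self]
    exact ((hg.differentiable (by simp)) _).hasFDerivAt
  exact h2.comp_hasDerivAt (p.2 J) h1

theorem lineU_const {N k : ℕ} (g : FinJet N k → ℝ) {J : MIdx N} (hJ : J ∉ idxLE N k) (p : Jet N)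
    (t : ℝ) : (g ∘ toFinJet k) (p.1, Function.update p.2 J t) = (g ∘ toFinJet k) p := by
  have e : (fun K : idxLE N k => Function.update p.2 J t K) = fun K : idxLE N k => p.2 K := by
    ext K
    have : (K : MIdx N) ≠ J := fun h' => hJ (h' ▸ K.2)
    simp [this]
  simp only [Function.comp, toFinJet, e]

theorem pdX_comp {N k : ℕ} {g : FinJet N k → ℝ} (hg : ContDiff ℝ ∞ g) (i : Fin N) :
    pdX i (g ∘ toFinJet k) = (fun q => fderiv ℝ g q (Pi.single i 1, 0)) ∘ toFinJet k :=
  funext fun p => (hasDerivAt_lineX hg i p).deriv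

theorem pdU_comp {N k : ℕ} {g : FinJet N k → ℝ} (hg : ContDiff ℝ ∞ g)
    {J : MIdx N} (hJ : J ∈ idxLE N k) :
    pdU J (g ∘ toFinJet k) =
      (fun q => fderiv ℝ g q (0, Pi.single ⟨J, hJ⟩ 1)) ∘ toFinJet k :=
  funext fun p => (hasDerivAt_lineU hg hJ p).deriv

theorem pdU_comp_of_notMem {N k : ℕ} (g : FinJet N k → ℝ) {J : MIdx N} (hJ : J ∉ idxLE N k) :
    pdU J (g ∘ toFinJet k) = 0 := by
  funext p
  unfold pdU
  simp only [lineU_const g hJ p, deriv_const, Pi.zero_apply]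

theorem contDiff_dir {N k : ℕ} {g : FinJet N k → ℝ} (hg : ContDiff ℝ ∞ g) (v : FinJet N k) :
    ContDiff ℝ ∞ (fun q => fderiv ℝ g q v) :=
  (hg.fderiv_right (by simp)).clm_apply contDiff_const

theorem isLocal_pdX {N : ℕ} (i : Fin N) {f : Jet N → ℝ} (hf : IsLocal f) : IsLocal (pdX i f) := by
  obtain ⟨k, g, hg, rfl⟩ := hf
  exact ⟨k, _, contDiff_dir hg _, pdX_comp hg i⟩

theorem isLocal_pdU {N : ℕ} (J : MIdx N) {f : Jet N → ℝ} (hf : IsLocal f) :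
    IsLocal (pdU J f) := by
  obtain ⟨k, g, hg, rfl⟩ := hf
  by_cases hJ : J ∈ idxLE N k
  · exact ⟨k, _, contDiff_dir hg _, pdU_comp hg hJ⟩
  · rw [pdU_comp_of_notMem g hJ]
    exact (Loc N).zero_mem

theorem isLocal_coord {N : ℕ} (J : MIdx N) : IsLocal (fun p : Jet N => p.2 J) :=
  ⟨order J, fun q => q.2 ⟨J, mem_idxLE.2 le_rfl⟩, by fun_prop, rfl⟩

theorem finite_pdU {N : ℕ} {f : Jet N → ℝ} (hf : IsLocal f) :
    ∃ s : Finset (MIdx N), ∀ J ∉ s, pdU J f = 0 := by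
  obtain ⟨k, g, hg, rfl⟩ := hf
  exact ⟨idxLE N k, fun J hJ => pdU_comp_of_notMem g hJ⟩

theorem totD_eq_sum {N : ℕ} (i : Fin N) {f : Jet N → ℝ} {s : Finset (MIdx N)}
    (hs : ∀ J ∉ s, pdU J f = 0) (p : Jet N) :
    totD i f p = pdX i f p + ∑ J ∈ s, p.2 (raise i J) * pdU J f p := by
  unfold totD
  congr 1
  apply finsum_eq_sum_of_support_subset
  intro J hJ
  by_contra h
  exact hJ (by simp [hs J h])

theorem isLocal_totD {N : ℕ} (i : Fin N) {f : Jet N → ℝ} (hf : IsLocal f) :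
    IsLocal (totD i f) := by
  obtain ⟨s, hs⟩ := finite_pdU hf
  have : totD i f = pdX i f + ∑ J ∈ s, (fun p : Jet N => p.2 (raise i J)) * pdU J f := by
    funext p
    simp [totD_eq_sum i hs p]
  rw [this]
  exact (Loc N).add_mem (isLocal_pdX i hf) ((Loc N).sum_mem fun J _ =>
    (Loc N).mul_mem (isLocal_coord _) (isLocal_pdU J hf))

theorem differentiableAt_lineX {N : ℕ} (i : Fin N) {f : Jet N → ℝ} (hf : IsLocal f) (p : Jet N) :
    DifferentiableAt ℝ (fun t => f (Function.update p.1 i t, p.2)) (p.1 i) := by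
  obtain ⟨k, g, hg, rfl⟩ := hf
  exact (hasDerivAt_lineX hg i p).differentiableAt

theorem differentiableAt_lineU {N : ℕ} (J : MIdx N) {f : Jet N → ℝ} (hf : IsLocal f) (p : Jet N) :
    DifferentiableAt ℝ (fun t => f (p.1, Function.update p.2 J t)) (p.2 J) := by
  obtain ⟨k, g, hg, rfl⟩ := hf
  by_cases hJ : J ∈ idxLE N k
  · exact (hasDerivAt_lineU hg hJ p).differentiableAt
  · simp only [lineU_const g hJ p]
    exact differentiableAt_const _

theorem pdX_add {N : ℕ} (i : Fin N) {f g : Jet N → ℝ} (hf : IsLocal f) (hg : IsLocal g) :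
    pdX i (f + g) = pdX i f + pdX i g :=
  funext fun p => deriv_add (differentiableAt_lineX i hf p) (differentiableAt_lineX i hg p)

theorem pdU_add {N : ℕ} (J : MIdx N) {f g : Jet N → ℝ} (hf : IsLocal f) (hg : IsLocal g) :
    pdU J (f + g) = pdU J f + pdU J g :=
  funext fun p => deriv_add (differentiableAt_lineU J hf p) (differentiableAt_lineU J hg p)

theorem pdX_smul {N : ℕ} (i : Fin N) (c : ℝ) {f : Jet N → ℝ} (hf : IsLocal f) :
    pdX i (c • f) = c • pdX i f :=
  funext fun p => deriv_const_mul c (differentiableAt_lineX i hf p)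

theorem pdU_smul {N : ℕ} (J : MIdx N) (c : ℝ) {f : Jet N → ℝ} (hf : IsLocal f) :
    pdU J (c • f) = c • pdU J f :=
  funext fun p => deriv_const_mul c (differentiableAt_lineU J hf p)

/-- `∂/∂u_J` as a linear operator on `Loc(E)`. -/
def partialU {N : ℕ} (J : MIdx N) : Module.End ℝ (Loc N) where
  toFun f := ⟨pdU J f.1, isLocal_pdU J f.2⟩
  map_add' f g := Subtype.ext (pdU_add J f.2 g.2)
  map_smul' c f := Subtype.ext (pdU_smul J c f.2)

/-- The total derivative `d/dx^i` as a linear operator on `Loc(E)`. -/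
def totalD {N : ℕ} (i : Fin N) : Module.End ℝ (Loc N) where
  toFun f := ⟨totD i f.1, isLocal_totD i f.2⟩
  map_add' f g := by
    apply Subtype.ext
    funext p
    obtain ⟨s, hs⟩ := finite_pdU f.2
    obtain ⟨t, ht⟩ := finite_pdU g.2
    have h1 : ∀ J ∉ s ∪ t, pdU J f.1 = 0 := fun J hJ => hs J fun h => hJ (Finset.mem_union_left _ h)
    have h2 : ∀ J ∉ s ∪ t, pdU J g.1 = 0 := fun J hJ => ht J fun h => hJ (Finset.mem_union_right _ h)
    have h3 : ∀ J ∉ s ∪ t, pdU J (f.1 + g.1) = 0 := fun J hJ => by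
      rw [pdU_add J f.2 g.2, h1 J hJ, h2 J hJ, add_zero]
    change totD i (f.1 + g.1) p = totD i f.1 p + totD i g.1 p
    rw [totD_eq_sum i h1, totD_eq_sum i h2, totD_eq_sum i h3, pdX_add i f.2 g.2]
    simp only [pdU_add _ f.2 g.2, Pi.add_apply, mul_add, Finset.sum_add_distrib]
    ring
  map_smul' c f := by
    apply Subtype.ext
    funext p
    obtain ⟨s, hs⟩ := finite_pdU f.2
    have h3 : ∀ J ∉ s, pdU J (c • f.1) = 0 := fun J hJ => by
      rw [pdU_smul J c f.2, hs J hJ, smul_zero]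
    change totD i (c • f.1) p = c * totD i f.1 p
    rw [totD_eq_sum i hs, totD_eq_sum i h3, pdX_smul i c f.2, mul_add, Finset.mul_sum]
    simp only [pdU_smul _ c f.2, Pi.smul_apply, smul_eq_mul]
    congr 1
    exact Finset.sum_congr rfl fun J _ => by ring

theorem partialU_commute {N : ℕ} (J K : MIdx N) : Commute (partialU J) (partialU K) := by
  apply LinearMap.ext
  rintro ⟨f, k, g, hg, rfl⟩
  apply Subtype.ext
  change pdU J (pdU K (g ∘ toFinJet k)) = pdU K (pdU J (g ∘ toFinJet k))
  have h0 : ∀ L : MIdx N, pdU L (0 : Jet N → ℝ) = 0 := fun L => by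
    funext p; simp [pdU]
  by_cases hJ : J ∈ idxLE N k <;> by_cases hK : K ∈ idxLE N k
  · rw [pdU_comp hg hJ, pdU_comp hg hK, pdU_comp (contDiff_dir hg _) hJ,
      pdU_comp (contDiff_dir hg _) hK]
    congr 1
    funext q
    have hd : DifferentiableAt ℝ (fderiv ℝ g) q :=
      ((hg.fderiv_right (m := ∞) (by simp)).differentiable (by simp)) q
    have hv : ∀ v w, fderiv ℝ (fun q => fderiv ℝ g q v) q w = fderiv ℝ (fderiv ℝ g) q w v := by
      intro v w
      rw [fderiv_clm_apply hd (differentiableAt_const _)]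
      simp
    rw [hv, hv]
    exact (hg.contDiffAt.isSymmSndFDerivAt (by
      rw [minSmoothness_of_isRCLikeNormedField]
      exact WithTop.coe_le_coe.2 (le_top : (2 : ℕ∞) ≤ ⊤))) _ _
  · rw [pdU_comp_of_notMem g hK, h0, pdU_comp hg hJ, pdU_comp_of_notMem _ hK]
  · rw [pdU_comp_of_notMem g hJ, h0, pdU_comp hg hK, pdU_comp_of_notMem _ hJ]
  · rw [pdU_comp_of_notMem g hK, pdU_comp_of_notMem g hJ, h0, h0]

/-- `(d/dx)^I = (d/dx^1)^{i_1} ⋯ (d/dx^N)^{i_N}`. -/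
def totalPow {N : ℕ} (I : MIdx N) : Module.End ℝ (Loc N) :=
  (List.ofFn fun i => totalD i ^ I i).prod

/-- Exponents of vertical derivatives: finitely supported functions on multi-indices. -/
abbrev VIdx (N : ℕ) : Type := MIdx N →₀ ℕ

/-- `(∂/∂u)^α = ∏_J (∂/∂u_J)^{α(J)}`. -/
def partialPow {N : ℕ} (α : VIdx N) : Module.End ℝ (Loc N) :=
  α.support.noncommProd (fun J => partialU J ^ α J)
    fun J _ K _ _ => (partialU_commute J K).pow_pow _ _

/-- The formal differential degree of `α`: the maximal order of a `J` with `α(J) ≠ 0`. -/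
def degF {N : ℕ} (α : VIdx N) : ℕ := α.support.sup order

/-! ### Multilinear local differential operators and their characteristic -/

/-- `n`-linear maps `Loc(E)^{⊗ n} → Loc(E)`. -/
abbrev MultiOp (N n : ℕ) : Type := MultilinearMap ℝ (fun _ : Fin n => Loc N) (Loc N)

/-- The indices `(I_1, …, I_n; α_1, …, α_n)`. -/
structure Idx (N n : ℕ) where
  /-- the exponents of the total derivatives -/
  I : Fin n → MIdx N
  /-- the exponents of the vertical derivatives -/
  α : Fin n → VIdx N

/-- For each `m`, only finitely many coefficients with `∑ deg_f(α_j) ≤ m` are nonzero. -/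
def FiniteCoeffs {N n : ℕ} (p : Idx N n → Loc N) : Prop :=
  ∀ m : ℕ, {k : Idx N n | ∑ j, degF (k.α j) ≤ m ∧ p k ≠ 0}.Finite

/-- `A` is an `n`-multilinear local differential operator. For coefficients satisfying the
finiteness condition the sum has only finitely many nonzero terms. -/
def IsLDO {N n : ℕ} (A : MultiOp N n) : Prop :=
  ∃ p : Idx N n → Loc N, FiniteCoeffs p ∧
    ∀ f : Fin n → Loc N,
      A f = ∑ᶠ k : Idx N n, p k * ∏ j, totalPow (k.I j) (partialPow (k.α j) (f j))

/-- `A ∘ d/dx^i_j`: the total derivative `d/dx^i` is applied to the `j`-th argument of `A`. -/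
def compD {N n : ℕ} (i : Fin N) (j : Fin n) : Module.End ℝ (MultiOp N n) where
  toFun A := A.compLinearMap fun l => if l = j then totalD i else LinearMap.id
  map_add' _ _ := rfl
  map_smul' _ _ := rfl

theorem compD_apply {N n : ℕ} (i : Fin N) (j : Fin n) (A : MultiOp N n) (f : Fin n → Loc N) :
    compD i j A f = A (Function.update f j (totalD i (f j))) := by
  change A _ = A _
  congr 1
  funext l
  by_cases h : l = j
  · subst h; simp
  · simp [h]

/-- Precomposition with `d/dy^i_1 = d/dx^i_1 + ⋯ + d/dx^i_n`. -/
def compY {N n : ℕ} (i : Fin N) : Module.End ℝ (MultiOp N n) := ∑ j, compD i j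

/-- The polarized monomial
`(d/dy_1)^{I_1} (d/dy_2)^{I_2} ⋯ (d/dy_n)^{I_n} (∂/∂u_1)^{α_1} ⋯ (∂/∂u_n)^{α_n}`,
followed by multiplication of the `n` results.
Here `d/dy^i_1 = ∑_j d/dx^i_j` and `d/dy^i_j = d/dx^i_j` for `j ≥ 2`. The slots are numbered from
`0`. The derivatives in `y` act after those in `u`, so they are the innermost precompositions with
the product. -/
def polMonomial {N n : ℕ} [NeZero n] (k : Idx N n) : MultiOp N n :=
  ((List.ofFn fun i => compY i ^ k.I 0 i).prod
    (MultilinearMap.mkPiAlgebra ℝ (Fin n) (Loc N))).compLinearMap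
      fun j => (if j = 0 then 1 else totalPow (k.I j)) * partialPow (k.α j)

/-- `A` has the polarized form with coefficients `q`. -/
def HasPolarizedForm {N n : ℕ} [NeZero n] (A : MultiOp N n) (q : Idx N n → Loc N) : Prop :=
  FiniteCoeffs q ∧ ∀ f : Fin n → Loc N, A f = ∑ᶠ k : Idx N n, q k * polMonomial k f

/-- `B = χ(A)`: if `A = ∑ q_k (d/dy_1)^{I_1} ⋯` in polarized form, then
`B = ∑ (-1)^{|I_1|} ((d/dx)^{I_1} q_k) (d/dy_2)^{I_2} ⋯ (d/dy_n)^{I_n} (∂/∂u_1)^{α_1} ⋯`.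
(The polarized coefficients of an operator are unique, so `B` is determined by `A`.) -/
def IsCharacteristic {N n : ℕ} [NeZero n] (A B : MultiOp N n) : Prop :=
  ∃ q : Idx N n → Loc N, HasPolarizedForm A q ∧
    ∀ f : Fin n → Loc N, B f = ∑ᶠ k : Idx N n,
      ((-1) ^ order (k.I 0) * totalPow (k.I 0) (q k)) *
        polMonomial ⟨Function.update k.I 0 0, k.α⟩ f

/-! ### The horizontal complex and its operator endomorphisms -/

/-- Horizontal forms of all degrees: `w = ∑_S w_S dx^S`, where `dx^S` is the wedge product of the
`dx^i`, `i ∈ S`, in increasing order. -/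
abbrev Hor (N : ℕ) : Type := Finset (Fin N) → Loc N

/-- `w` lies in `Ω_s = Ω^{N-s,0}`. -/
def InDegree {N : ℕ} (s : ℕ) (w : Hor N) : Prop := ∀ S, w S ≠ 0 → S.card + s = N

/-- The horizontal differential `d_H w = ∑_i dx^i ∧ (d/dx^i) w`. For `i ∈ T`, moving `dx^i` into
its place in `dx^T` produces the sign `(-1)^{#{j ∈ T : j < i}}`. -/
def dH {N : ℕ} : Module.End ℝ (Hor N) where
  toFun w T := ∑ i ∈ T, (-1) ^ (T.filter (· < i)).card * totalD i (w (T.erase i))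
  map_add' w η := by
    funext T
    simp [mul_add, Finset.sum_add_distrib]
  map_smul' c w := by
    funext T
    simp [Finset.smul_sum]

/-- The operator `w ↦ (-1)^s w` for `w` in `Ω_s`. -/
def degSign {N : ℕ} : Module.End ℝ (Hor N) where
  toFun w S := (-1) ^ (N - S.card) * w S
  map_add' w η := by
    funext S
    simp [mul_add]
  map_smul' c w := by
    funext S
    simp

/-- Linear maps `(Ω_*)^{⊗ n} → Ω_*`, as `n`-linear maps. -/
abbrev HorOp (N n : ℕ) : Type := MultilinearMap ℝ (fun _ : Fin n => Hor N) (Hor N)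

/-- `f ∘ d_H^{⊗ n}`, where
`d_H^{⊗ n}(w_1 ⊗ ⋯ ⊗ w_n) = ∑_j (-1)^{|w_1| + ⋯ + |w_{j-1}|} w_1 ⊗ ⋯ ⊗ d_H w_j ⊗ ⋯ ⊗ w_n`
and `|w| = s` for `w` in `Ω_s`. -/
def compTensorD {N n : ℕ} (f : HorOp N n) : HorOp N n :=
  ∑ j, f.compLinearMap fun l => if l < j then degSign else if l = j then dH else LinearMap.id

/-- The matrix coefficient of `f` from `(dx^{S_1}, …, dx^{S_n})` to `dx^T`. -/
def matrixCoeff {N n : ℕ} (f : HorOp N n) (S : Fin n → Finset (Fin N)) (T : Finset (Fin N)) :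
    MultiOp N n :=
  (LinearMap.proj T : Hor N →ₗ[ℝ] Loc N).compMultilinearMap
    (f.compLinearMap fun j => LinearMap.single ℝ (fun _ => Loc N) (S j))

/-- `f` belongs to `DEnd_0(n)`: it consists of maps `f_s : [(Ω_*)^{⊗ n}]_s → Ω_s`, and its matrix
coefficients are local differential operators. -/
structure IsDEndZero {N n : ℕ} (f : HorOp N n) : Prop where
  degree : ∀ (w : Fin n → Hor N) (r : Fin n → ℕ),
    (∀ j, InDegree (r j) (w j)) → InDegree (∑ j, r j) (f w)
  ldo : ∀ S T, IsLDO (matrixCoeff f S T)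

/-- `f` lifts `A`: it is a chain map in `DEnd_0(n)` and `f_0 = A`, where `Ω_0` is identified with
`Loc(E)` through `g ↦ g dx^1 ∧ ⋯ ∧ dx^N`. -/
structure IsLift {N n : ℕ} (A : MultiOp N n) (f : HorOp N n) : Prop where
  dEnd : IsDEndZero f
  chain : dH.compMultilinearMap f = compTensorD f
  zero : matrixCoeff f (fun _ => Finset.univ) Finset.univ = A

/-- The component `f_s : [(Ω_*)^{⊗ n}]_s → Ω_s` vanishes. -/
def ComponentZero {N n : ℕ} (f : HorOp N n) (s : ℕ) : Prop :=
  ∀ (w : Fin n → Hor N) (r : Fin n → ℕ),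
    (∀ j, InDegree (r j) (w j)) → ∑ j, r j = s → f w = 0

end HorizontalLDO

end

/-! # Lifts of multilinear local differential operators

Composition on the left with `d/dx^i` makes the space of local differential operators a module over
the polynomial ring in commuting variables `d/dx^1, …, d/dx^N`, and this module is free in a
suitable sense: every operator has a unique *normal form* `A = ∑_I (d/dx)^I ∘ R_I`, where the `R_I`
involve no total derivatives in the first argument (`exists_normalForms`,
`eq_zero_of_normalForms`). Existence is the Leibniz rule: a derivative of the first argument is a
derivative of the value minus derivatives of the other arguments (`opFilt_le`). Uniqueness uses that
the `R_I` commute with multiplication of the first argument by the coordinates `x^i`, so that the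
commutator of `A` with `x^i` has the normal form `∑_I I^i (d/dx)^{I - e_i} ∘ R_I`, and the
coefficients can be recovered inductively. The characteristic of `A` is the constant coefficient
`R_0`: moving a coefficient past `(d/dx)^I` integrates by parts
(`smul_leftPow_mem_normalPairs`, `leftD_polTerm_mem`). Uniqueness of polarized coefficients is not
needed.

In terms of normal forms, the complex of operators with values in horizontal forms is the Koszul
complex of the shifts `R_I ↦ R_{I - e_i}`. Its Laplacian multiplies the coefficient of
`(d/dx)^I dx^T` by `|I| + N - |T|`, which vanishes only for `I = 0` in the top form degree
(`koszul_exact`). Hence the complex is exact in positive degrees, and in degree zero an operator is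
a total divergence exactly when its characteristic vanishes (`exists_primitive`,
`isCharacteristic_sum_leftD`).

The degree one part of a lift of `A` writes each `A d/dx^i_j` as a total divergence
(`IsLift.isCharacteristic_compD`). Conversely, if `f_s` is constructed, then `f_s d_H^{⊗ n}` is
closed and, for `s = 0` by hypothesis, has vanishing characteristic, so it equals `d_H f_{s+1}`
(`exists_lift`). If `A = d_H h`, one may take `f_1 = h d_H^{⊗ n}`, for which
`f_1 d_H^{⊗ n} = 0` (`exists_short_lift`).

Coefficient families of operators are infinite, but only finitely many terms of each vertical order
`∑_j deg_f(α_j)` occur, and terms of large order annihilate a given tuple of local functions. All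
constructions are therefore made for finite operators compatibly with the filtration by vertical
order and summed afterwards (`IsLDO.exists_seq`, `isLDO_of_seq`). -/

noncomputable section

namespace HorizontalLDO

/-! ### Calculus of total and vertical derivatives -/

theorem pdX_mul {N : ℕ} (i : Fin N) {f g : Jet N → ℝ} (hf : IsLocal f) (hg : IsLocal g) :
    pdX i (f * g) = pdX i f * g + f * pdX i g := by
  funext p
  have h := deriv_mul (differentiableAt_lineX i hf p) (differentiableAt_lineX i hg p)
  rw [Function.update_eq_self] at h
  exact h

theorem pdU_mul {N : ℕ} (J : MIdx N) {f g : Jet N → ℝ} (hf : IsLocal f) (hg : IsLocal g) :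
    pdU J (f * g) = pdU J f * g + f * pdU J g := by
  funext p
  have h := deriv_mul (differentiableAt_lineU J hf p) (differentiableAt_lineU J hg p)
  rw [Function.update_eq_self] at h
  exact h

/-- `∂/∂x^i` as a linear operator on `Loc(E)`. -/
def partialX {N : ℕ} (i : Fin N) : Module.End ℝ (Loc N) where
  toFun f := ⟨pdX i f.1, isLocal_pdX i f.2⟩
  map_add' f g := Subtype.ext (pdX_add i f.2 g.2)
  map_smul' c f := Subtype.ext (pdX_smul i c f.2)

theorem partialX_mul {N : ℕ} (i : Fin N) (f g : Loc N) :
    partialX i (f * g) = partialX i f * g + f * partialX i g :=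
  Subtype.ext (pdX_mul i f.2 g.2)

theorem partialU_mul {N : ℕ} (J : MIdx N) (f g : Loc N) :
    partialU J (f * g) = partialU J f * g + f * partialU J g :=
  Subtype.ext (pdU_mul J f.2 g.2)

/-- The coordinate `u_J` as a local function. -/
def coordU {N : ℕ} (J : MIdx N) : Loc N := ⟨fun p => p.2 J, isLocal_coord J⟩

/-- The coordinate `x^i` as a local function. -/
def coordX {N : ℕ} (i : Fin N) : Loc N :=
  ⟨fun p => p.1 i, 0, fun q => q.1 i, by fun_prop, rfl⟩

theorem exists_jetOrder {N : ℕ} (f : Loc N) : ∃ k, ∀ J : MIdx N, k < order J → partialU J f = 0 := by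
  obtain ⟨f, k, g, hg, rfl⟩ := f
  exact ⟨k, fun J hJ => Subtype.ext (pdU_comp_of_notMem g fun h => by
    have := mem_idxLE.1 h; omega)⟩

theorem totalD_eq_sum {N : ℕ} (i : Fin N) {f : Loc N} {s : Finset (MIdx N)}
    (hs : ∀ J ∉ s, partialU J f = 0) :
    totalD i f = partialX i f + ∑ J ∈ s, coordU (raise i J) * partialU J f := by
  apply Subtype.ext
  funext p
  have := totD_eq_sum i (f := f.1) (s := s) (fun J hJ => congrArg Subtype.val (hs J hJ)) p
  change totD i f.1 p = _
  simpa [partialX, partialU, coordU] using this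

theorem exists_finset_partialU {N : ℕ} (f : Loc N) :
    ∃ s : Finset (MIdx N), ∀ J ∉ s, partialU J f = 0 := by
  obtain ⟨s, hs⟩ := finite_pdU f.2
  exact ⟨s, fun J hJ => Subtype.ext (hs J hJ)⟩

theorem totalD_mul {N : ℕ} (i : Fin N) (f g : Loc N) :
    totalD i (f * g) = totalD i f * g + f * totalD i g := by
  classical
  obtain ⟨s, hs⟩ := exists_finset_partialU f
  obtain ⟨t, ht⟩ := exists_finset_partialU g
  have h1 : ∀ J ∉ s ∪ t, partialU J f = 0 := fun J hJ => hs J fun h => hJ (Finset.mem_union_left _ h)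
  have h2 : ∀ J ∉ s ∪ t, partialU J g = 0 :=
    fun J hJ => ht J fun h => hJ (Finset.mem_union_right _ h)
  have h3 : ∀ J ∉ s ∪ t, partialU J (f * g) = 0 := fun J hJ => by
    rw [partialU_mul, h1 J hJ, h2 J hJ]; simp
  rw [totalD_eq_sum i h1, totalD_eq_sum i h2, totalD_eq_sum i h3, partialX_mul]
  simp only [partialU_mul, mul_add, add_mul, Finset.sum_add_distrib, Finset.sum_mul,
    Finset.mul_sum, mul_assoc, mul_left_comm f]
  abel

theorem fderiv_dir_comm {N k : ℕ} {g : FinJet N k → ℝ} (hg : ContDiff ℝ ∞ g) (v w : FinJet N k) :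
    (fun q => fderiv ℝ (fun q => fderiv ℝ g q v) q w) =
      fun q => fderiv ℝ (fun q => fderiv ℝ g q w) q v := by
  funext q
  have hd : DifferentiableAt ℝ (fderiv ℝ g) q :=
    ((hg.fderiv_right (m := ∞) (by simp)).differentiable (by simp)) q
  have hv : ∀ v w, fderiv ℝ (fun q => fderiv ℝ g q v) q w = fderiv ℝ (fderiv ℝ g) q w v := by
    intro v w
    rw [fderiv_clm_apply hd (differentiableAt_const _)]
    simp
  rw [hv, hv]
  exact (hg.contDiffAt.isSymmSndFDerivAt (by
    rw [minSmoothness_of_isRCLikeNormedField]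
    exact WithTop.coe_le_coe.2 (le_top : (2 : ℕ∞) ≤ ⊤))) _ _

theorem partialX_comm {N : ℕ} (i j : Fin N) (f : Loc N) :
    partialX i (partialX j f) = partialX j (partialX i f) := by
  obtain ⟨f, k, g, hg, rfl⟩ := f
  apply Subtype.ext
  change pdX i (pdX j (g ∘ toFinJet k)) = pdX j (pdX i (g ∘ toFinJet k))
  rw [pdX_comp hg, pdX_comp hg, pdX_comp (contDiff_dir hg _), pdX_comp (contDiff_dir hg _),
    fderiv_dir_comm hg]

theorem partialU_partialX {N : ℕ} (J : MIdx N) (i : Fin N) (f : Loc N) :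
    partialU J (partialX i f) = partialX i (partialU J f) := by
  obtain ⟨f, k, g, hg, rfl⟩ := f
  apply Subtype.ext
  change pdU J (pdX i (g ∘ toFinJet k)) = pdX i (pdU J (g ∘ toFinJet k))
  by_cases hJ : J ∈ idxLE N k
  · rw [pdX_comp hg, pdU_comp hg hJ, pdX_comp (contDiff_dir hg _), pdU_comp (contDiff_dir hg _) hJ,
      fderiv_dir_comm hg]
  · rw [pdX_comp hg, pdU_comp_of_notMem _ hJ, pdU_comp_of_notMem _ hJ]
    funext p
    simp [pdX]

theorem partialU_comm {N : ℕ} (J K : MIdx N) (f : Loc N) :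
    partialU J (partialU K f) = partialU K (partialU J f) :=
  LinearMap.congr_fun (partialU_commute J K).eq f

theorem partialU_coordU {N : ℕ} (J K : MIdx N) :
    partialU J (coordU K) = if J = K then 1 else 0 := by
  apply Subtype.ext
  funext p
  change deriv (fun t => Function.update p.2 J t K) (p.2 J) = _
  split_ifs with h
  · subst h; simp
  · simp [Function.update_of_ne (Ne.symm h)]

theorem partialU_coordX {N : ℕ} (J : MIdx N) (i : Fin N) : partialU J (coordX i) = 0 := by
  apply Subtype.ext
  funext p
  change deriv (fun t => p.1 i) (p.2 J) = 0
  simp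

theorem totalD_coordU {N : ℕ} (i : Fin N) (J : MIdx N) :
    totalD i (coordU J) = coordU (raise i J) := by
  rw [totalD_eq_sum (s := {J}) i fun K hK => by
    rw [partialU_coordU, if_neg (by simpa using hK)]]
  have : partialX i (coordU J) = 0 := by
    apply Subtype.ext
    funext p
    change deriv (fun t => p.2 J) (p.1 i) = 0
    simp
  simp [this, partialU_coordU]

theorem totalD_coordX {N : ℕ} (i j : Fin N) :
    totalD i (coordX j) = if i = j then 1 else 0 := by
  rw [totalD_eq_sum (s := ∅) i fun K _ => partialU_coordX K j]
  simp only [Finset.sum_empty, add_zero]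
  apply Subtype.ext
  funext p
  change deriv (fun t => Function.update p.1 i t j) (p.1 i) = _
  split_ifs with h
  · subst h; simp
  · simp [Function.update_of_ne (Ne.symm h)]

theorem raise_comm {N : ℕ} (i j : Fin N) (J : MIdx N) : raise i (raise j J) = raise j (raise i J) := by
  unfold raise; abel

theorem raise_injective {N : ℕ} (i : Fin N) : Function.Injective (raise i : MIdx N → MIdx N) :=
  fun _ _ h => add_right_cancel h

theorem order_raise {N : ℕ} (i : Fin N) (J : MIdx N) : order (raise i J) = order J + 1 := by
  simp [order, raise, Finset.sum_add_distrib]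

theorem order_zero {N : ℕ} : order (0 : MIdx N) = 0 := by simp [order]

/-- The total derivatives commute, since `[d/dx^i, d/dx^j] f = ∑_J (u_{ijJ} - u_{jiJ}) ∂f/∂u_J`. -/
theorem totalD_commute {N : ℕ} (i j : Fin N) : Commute (totalD i) (totalD j) := by
  apply LinearMap.ext
  intro f
  change totalD i (totalD j f) = totalD j (totalD i f)
  obtain ⟨s, hs⟩ := exists_finset_partialU f
  have hX : ∀ l, ∀ J ∉ s, partialU J (partialX l f) = 0 := fun l J hJ => by
    rw [partialU_partialX, hs J hJ, map_zero]
  have hU : ∀ K, ∀ J ∉ s, partialU J (partialU K f) = 0 := fun K J hJ => by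
    rw [partialU_comm, hs J hJ, map_zero]
  have key : ∀ a b : Fin N, totalD a (totalD b f) = partialX a (partialX b f) +
      ∑ J ∈ s, (coordU (raise a J) * partialX b (partialU J f)
        + coordU (raise b J) * partialX a (partialU J f))
      + ∑ J ∈ s, coordU (raise a (raise b J)) * partialU J f
      + ∑ J ∈ s, ∑ K ∈ s, coordU (raise b J) * coordU (raise a K) * partialU K (partialU J f) := by
    intro a b
    rw [totalD_eq_sum b hs, map_add, map_sum, totalD_eq_sum a (hX b)]
    simp only [totalD_mul, totalD_coordU, totalD_eq_sum a (hU _), mul_add, Finset.mul_sum,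
      Finset.sum_add_distrib, partialU_partialX, mul_assoc]
    abel
  rw [key i j, key j i, partialX_comm i j,
    Finset.sum_comm (f := fun J K => coordU (raise j J) * coordU (raise i K) *
      partialU K (partialU J f))]
  simp only [raise_comm i j, mul_comm (coordU (raise j _)) (coordU (raise i _)),
    add_comm (coordU (raise j _) * _), fun J K => partialU_comm J K f]

/-- The commutation rule `[∂/∂u_{iJ}, d/dx^i] = ∂/∂u_J`. -/
theorem partialU_raise_totalD {N : ℕ} (i : Fin N) (J : MIdx N) (f : Loc N) :
    partialU (raise i J) (totalD i f) = totalD i (partialU (raise i J) f) + partialU J f := by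
  classical
  obtain ⟨s, hs⟩ := exists_finset_partialU f
  have hU : ∀ K, ∀ J ∉ s, partialU J (partialU K f) = 0 := fun K J hJ => by
    rw [partialU_comm, hs J hJ, map_zero]
  rw [totalD_eq_sum i hs, totalD_eq_sum i (hU _), map_add, map_sum, partialU_partialX]
  simp only [partialU_mul, partialU_coordU, (raise_injective i).eq_iff, Finset.sum_add_distrib,
    ite_mul, one_mul, zero_mul, Finset.sum_ite_eq, fun K => partialU_comm (raise i J) K f]
  split_ifs with h
  · abel
  · rw [hs J h]; abel

/-- The commutation rule `[∂/∂u_J, d/dx^i] = 0` for `J` with vanishing `i`-th entry. -/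
theorem partialU_totalD_of_eq_zero {N : ℕ} {i : Fin N} {J : MIdx N} (hJ : J i = 0) (f : Loc N) :
    partialU J (totalD i f) = totalD i (partialU J f) := by
  classical
  obtain ⟨s, hs⟩ := exists_finset_partialU f
  have hU : ∀ K, ∀ J ∉ s, partialU J (partialU K f) = 0 := fun K J hJ => by
    rw [partialU_comm, hs J hJ, map_zero]
  have hne : ∀ K, J ≠ raise i K := fun K h => by
    have := congrFun h i
    simp [raise, hJ] at this
  rw [totalD_eq_sum i hs, totalD_eq_sum i (hU _), map_add, map_sum, partialU_partialX]
  simp only [partialU_mul, partialU_coordU, hne, if_false, zero_mul, zero_add,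
    fun K => partialU_comm J K f]

/-! ### Powers of derivatives -/

theorem exists_raise {N : ℕ} {i : Fin N} {J : MIdx N} (h : J i ≠ 0) : ∃ K, J = raise i K := by
  refine ⟨J - Pi.single i 1, ?_⟩
  funext l
  by_cases hl : l = i
  · subst hl; simp [raise]; omega
  · simp [raise, hl]

/-- Induction over multi-indices, raising one entry at a time. -/
theorem MIdx.raise_induction {N : ℕ} {p : MIdx N → Prop} (h0 : p 0)
    (hs : ∀ i J, p J → p (raise i J)) (J : MIdx N) : p J := by
  induction h : order J generalizing J with
  | zero =>
    have : J = 0 := by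
      funext i
      simpa [order] using congrArg id ((Finset.sum_eq_zero_iff.1 h) i (Finset.mem_univ i))
    rwa [this]
  | succ m ih =>
    obtain ⟨i, hi⟩ : ∃ i, J i ≠ 0 := by
      by_contra! h'
      simp [order, h'] at h
    obtain ⟨K, rfl⟩ := exists_raise hi
    exact hs i K (ih K (by rw [order_raise] at h; omega))

theorem totalPow_zero {N : ℕ} : totalPow (0 : MIdx N) = 1 := by
  simp [totalPow]

theorem prod_ofFn_pow_update {M : Type*} [Monoid M] {N : ℕ} (a : Fin N → M)
    (ha : ∀ i j, Commute (a i) (a j)) (i : Fin N) (J : MIdx N) :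
    (List.ofFn fun l => a l ^ raise i J l).prod = a i * (List.ofFn fun l => a l ^ J l).prod := by
  induction N with
  | zero => exact i.elim0
  | succ N ih =>
    simp only [List.ofFn_succ, List.prod_cons]
    refine Fin.cases ?_ (fun i => ?_) i
    · have : ∀ l : Fin N, raise 0 J l.succ = J l.succ := fun l => by simp [raise]
      simp only [this]
      have h : raise 0 J 0 = J 0 + 1 := by simp [raise]
      rw [h, pow_succ', mul_assoc]
    · have h1 : ∀ l : Fin N, raise i.succ J l.succ = raise i (fun l => J l.succ) l := fun l => by
        simp [raise, Pi.single_apply]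
      have h0 : raise i.succ J 0 = J 0 := by simp [raise]
      simp only [h1, h0]
      rw [ih (fun l => a l.succ) (fun _ _ => ha _ _) i, ← mul_assoc, ← mul_assoc,
        ((ha i.succ 0).pow_right (J 0)).eq]

theorem totalPow_raise {N : ℕ} (i : Fin N) (I : MIdx N) :
    totalPow (raise i I) = totalD i * totalPow I :=
  prod_ofFn_pow_update _ totalD_commute i I

theorem totalD_commute_totalPow {N : ℕ} (i : Fin N) (I : MIdx N) :
    Commute (totalD i) (totalPow I) := by
  induction I using MIdx.raise_induction with
  | h0 => rw [totalPow_zero]; exact Commute.one_right _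
  | hs j J ih => rw [totalPow_raise]; exact (totalD_commute i j).mul_right ih

theorem totalPow_raise_apply {N : ℕ} (i : Fin N) (I : MIdx N) (f : Loc N) :
    totalPow (raise i I) f = totalD i (totalPow I f) := by
  rw [totalPow_raise]; rfl

theorem totalPow_raise_apply' {N : ℕ} (i : Fin N) (I : MIdx N) (f : Loc N) :
    totalPow (raise i I) f = totalPow I (totalD i f) := by
  rw [totalPow_raise, (totalD_commute_totalPow i I).eq]; rfl

/-- Commuting multiplication by `x^i` past total derivatives:
`[(d/dx)^I, x^i] = I^i (d/dx)^{I - e_i}`. -/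
theorem totalPow_coordX_mul {N : ℕ} (I : MIdx N) (i : Fin N) (g : Loc N) :
    totalPow I (coordX i * g) =
      coordX i * totalPow I g + (I i : ℝ) • totalPow (I - Pi.single i 1) g := by
  induction I using MIdx.raise_induction with
  | h0 => simp [totalPow_zero]
  | hs j I ih =>
    rw [totalPow_raise_apply, ih, map_add, totalD_mul, totalD_coordX, map_smul, totalPow_raise_apply]
    by_cases hji : j = i
    · subst hji
      have h1 : raise j I - Pi.single j 1 = I := by unfold raise; exact add_tsub_cancel_right _ _
      rw [h1, if_pos rfl, one_mul, ← totalPow_raise_apply j (I - _)]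
      have h3 : (raise j I) j = I j + 1 := by simp [raise]
      by_cases h : I j = 0
      · rw [h3, h]; simp; abel
      · have h2 : raise j (I - Pi.single j 1) = I := by
          funext l
          by_cases hl : l = j
          · subst hl; simp [raise]; omega
          · simp [raise, hl]
        rw [h2, h3]
        push_cast
        rw [add_smul, one_smul]
        abel
    · have h3 : (raise j I) i = I i := by simp [raise, Ne.symm hji]
      have h2 : raise j I - Pi.single i 1 = raise j (I - Pi.single i 1) := by
        funext l
        by_cases hl : l = i
        · subst hl; simp [raise, Ne.symm hji]
        · simp [raise, hl]
      rw [if_neg hji, zero_mul, zero_add, h3, h2, totalPow_raise_apply]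

theorem partialPow_zero {N : ℕ} : partialPow (0 : VIdx N) = 1 := by
  simp [partialPow]

theorem pairwise_commute_partialU_pow {N : ℕ} (β : VIdx N) (s : Finset (MIdx N)) :
    (s : Set (MIdx N)).Pairwise (Function.onFun Commute fun J => partialU J ^ β J) :=
  fun J _ K _ _ => (partialU_commute J K).pow_pow _ _

theorem partialPow_eq_noncommProd {N : ℕ} (β : VIdx N) {s : Finset (MIdx N)}
    (hs : β.support ⊆ s) :
    partialPow β = s.noncommProd (fun J => partialU J ^ β J)
      (pairwise_commute_partialU_pow β s) := by
  classical
  obtain ⟨t, ht, rfl⟩ : ∃ t, Disjoint β.support t ∧ s = β.support ∪ t :=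
    ⟨s \ β.support, Finset.disjoint_sdiff, by rw [Finset.union_sdiff_of_subset hs]⟩
  rw [Finset.noncommProd_union_of_disjoint ht]
  rw [Finset.noncommProd_eq_pow_card t _ _ 1 (fun K hK => by
    rw [Finsupp.notMem_support_iff.1 (Finset.disjoint_right.1 ht hK), pow_zero]), one_pow, mul_one]
  rfl

theorem partialPow_add_single {N : ℕ} (α : VIdx N) (J : MIdx N) :
    partialPow (α + Finsupp.single J 1) = partialPow α * partialU J := by
  classical
  set s := insert J α.support
  have hJ : J ∈ s := Finset.mem_insert_self _ _
  rw [partialPow_eq_noncommProd α (s := s) (Finset.subset_insert _ _),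
    partialPow_eq_noncommProd (α + Finsupp.single J 1) (s := s) (by
      refine Finsupp.support_add.trans (Finset.union_subset (Finset.subset_insert _ _) ?_)
      exact Finsupp.support_single_subset.trans (by simpa using hJ))]
  rw [← Finset.noncommProd_erase_mul s hJ,
    ← Finset.noncommProd_erase_mul s hJ (fun J => partialU J ^ α J), mul_assoc, ← pow_succ]
  congr 1
  · refine Finset.noncommProd_congr rfl (fun K hK => ?_) _
    simp [(Finset.ne_of_mem_erase hK).symm]
  · simp

/-- Induction over exponents of vertical derivatives, one derivative at a time. -/
theorem VIdx.single_induction {N : ℕ} {p : VIdx N → Prop} (h0 : p 0)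
    (hs : ∀ α J, p α → p (α + Finsupp.single J 1)) (α : VIdx N) : p α := by
  suffices ∀ β, p β → p (β + α) by simpa using this 0 h0
  induction α using Finsupp.induction_linear with
  | zero => simp
  | add α γ h1 h2 => intro β hβ; rw [← add_assoc]; exact h2 _ (h1 _ hβ)
  | single J m =>
    induction m with
    | zero => simp
    | succ m ih =>
      intro β hβ
      rw [Finsupp.single_add, ← add_assoc]
      exact hs _ _ (ih _ hβ)

theorem degF_add_single {N : ℕ} (α : VIdx N) (J : MIdx N) :
    degF (α + Finsupp.single J 1) = max (degF α) (order J) := by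
  classical
  have : (α + Finsupp.single J 1).support = insert J α.support := by
    ext K
    by_cases h : J = K <;> simp [h, eq_comm]
  rw [degF, this, Finset.sup_insert, degF, max_comm]

theorem partialPow_eq_zero {N : ℕ} {f : Loc N} {k : ℕ}
    (hk : ∀ J : MIdx N, k < order J → partialU J f = 0) {α : VIdx N} (hα : k < degF α) :
    partialPow α f = 0 := by
  induction α using VIdx.single_induction generalizing f with
  | h0 => simp [degF] at hα
  | hs α J ih =>
    rw [partialPow_add_single]
    change partialPow α (partialU J f) = 0
    by_cases h : k < order J
    · rw [hk J h, map_zero]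
    · refine ih (fun K hK => ?_) ?_
      · rw [partialU_comm, hk K hK, map_zero]
      · rw [degF_add_single] at hα
        exact (lt_max_iff.1 hα).resolve_right h

theorem partialPow_coordX_mul {N : ℕ} (α : VIdx N) (i : Fin N) (f : Loc N) :
    partialPow α (coordX i * f) = coordX i * partialPow α f := by
  induction α using VIdx.single_induction generalizing f with
  | h0 => simp [partialPow_zero]
  | hs α J ih =>
    rw [partialPow_add_single]
    change partialPow α (partialU J _) = _ * partialPow α (partialU J f)
    rw [partialU_mul, partialU_coordX, zero_mul, zero_add, ih]

section

/-! ### Monomial operators and the filtration by vertical order -/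

variable {N n : ℕ}

theorem totalD_prod (i : Fin N) (g : Fin n → Loc N) :
    totalD i (∏ j, g j) = ∑ j, ∏ l, Function.update g j (totalD i (g j)) l := by
  classical
  have h1 : totalD i 1 = (0 : Loc N) := by
    have := totalD_mul i (1 : Loc N) 1
    simpa using this
  have key : ∀ s : Finset (Fin n), totalD i (∏ j ∈ s, g j) =
      ∑ j ∈ s, ∏ l ∈ s, Function.update g j (totalD i (g j)) l := by
    intro s
    induction s using Finset.induction_on with
    | empty => simpa using h1
    | insert a s ha ih =>
      rw [Finset.prod_insert ha, totalD_mul, ih, Finset.sum_insert ha, Finset.prod_insert ha,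
        Finset.mul_sum, Function.update_self]
      congr 1
      · congr 1
        exact Finset.prod_congr rfl fun l hl => by
          rw [Function.update_of_ne (ne_of_mem_of_not_mem hl ha)]
      · refine Finset.sum_congr rfl fun j hj => ?_
        rw [Finset.prod_insert ha, Function.update_of_ne (ne_of_mem_of_not_mem hj ha).symm]
  exact key Finset.univ

/-- The operator `(f_1, …, f_n) ↦ ∏_j w_j(f_j)`. -/
def opProd (w : Fin n → Module.End ℝ (Loc N)) : MultiOp N n :=
  (MultilinearMap.mkPiAlgebra ℝ (Fin n) (Loc N)).compLinearMap w

theorem opProd_apply (w : Fin n → Module.End ℝ (Loc N)) (f : Fin n → Loc N) :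
    opProd w f = ∏ j, w j (f j) := by
  simp [opProd]

/-- The monomial operator `(f_1, …, f_n) ↦ ∏_j (d/dx)^{I_j} (∂/∂u)^{α_j} f_j`. -/
def mono (κ : Idx N n) : MultiOp N n :=
  opProd fun j => totalPow (κ.I j) * partialPow (κ.α j)

theorem mono_apply (κ : Idx N n) (f : Fin n → Loc N) :
    mono κ f = ∏ j, totalPow (κ.I j) (partialPow (κ.α j) (f j)) :=
  opProd_apply _ f

/-- The total vertical degree `∑_j deg_f(α_j)`. -/
def Idx.deg (κ : Idx N n) : ℕ := ∑ j, degF (κ.α j)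

/-- The index obtained by applying one more `d/dx^i` in the `j`-th slot. -/
def Idx.raiseAt (i : Fin N) (j : Fin n) (κ : Idx N n) : Idx N n :=
  ⟨Function.update κ.I j (raise i (κ.I j)), κ.α⟩

/-- `d/dx^i ∘ A`, the total derivative applied to the value of `A`. -/
def leftD (i : Fin N) : Module.End ℝ (MultiOp N n) where
  toFun A := (totalD i).compMultilinearMap A
  map_add' A B := by ext f : 1; exact map_add (totalD i) _ _
  map_smul' c A := by ext f : 1; exact map_smul (totalD i) _ _

theorem leftD_apply (i : Fin N) (A : MultiOp N n) (f : Fin n → Loc N) :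
    leftD i A f = totalD i (A f) := rfl

theorem leftD_smul (i : Fin N) (c : Loc N) (A : MultiOp N n) :
    leftD i (c • A) = totalD i c • A + c • leftD i A := by
  ext f : 1
  exact totalD_mul i c (A f)

theorem compD_smul (i : Fin N) (j : Fin n) (c : Loc N) (A : MultiOp N n) :
    compD i j (c • A) = c • compD i j A := rfl

theorem mono_raiseAt_apply (i : Fin N) (j : Fin n) (κ : Idx N n) (f : Fin n → Loc N) :
    mono (κ.raiseAt i j) f = ∏ l, Function.update
      (fun l => totalPow (κ.I l) (partialPow (κ.α l) (f l))) j
      (totalD i (totalPow (κ.I j) (partialPow (κ.α j) (f j)))) l := by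
  rw [mono_apply]
  refine Finset.prod_congr rfl fun l _ => ?_
  by_cases h : l = j
  · subst h
    simp [Idx.raiseAt, totalPow_raise_apply]
  · simp [Idx.raiseAt, h]

theorem leftD_mono (i : Fin N) (κ : Idx N n) :
    leftD i (mono κ) = ∑ j, mono (κ.raiseAt i j) := by
  ext f : 1
  rw [leftD_apply, mono_apply, totalD_prod, sum_apply]
  exact Finset.sum_congr rfl fun j _ => (mono_raiseAt_apply i j κ f).symm

/-- Finite sums of monomial operators of vertical degree at least `k`, over `Loc(E)`. -/
def opFilt (N n k : ℕ) : Submodule (Loc N) (MultiOp N n) :=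
  Submodule.span _ (mono '' {κ | k ≤ κ.deg})

theorem mono_mem_opFilt {k : ℕ} {κ : Idx N n} (h : k ≤ κ.deg) : mono κ ∈ opFilt N n k :=
  Submodule.subset_span ⟨κ, h, rfl⟩

theorem smul_real_mem {F : Submodule (Loc N) (MultiOp N n)} (c : ℝ) {A : MultiOp N n}
    (hA : A ∈ F) : c • A ∈ F := by
  have : c • A = (algebraMap ℝ (Loc N) c) • A := by
    ext f : 1
    exact Algebra.smul_def c (A f)
  rw [this]
  exact Submodule.smul_mem _ _ hA

theorem leftD_mem_opFilt (i : Fin N) {k : ℕ} {A : MultiOp N n} (hA : A ∈ opFilt N n k) :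
    leftD i A ∈ opFilt N n k := by
  induction hA using Submodule.span_induction with
  | mem A h =>
    obtain ⟨κ, hκ, rfl⟩ := h
    rw [leftD_mono]
    exact Submodule.sum_mem _ fun j _ => mono_mem_opFilt hκ
  | zero => rw [map_zero]; exact zero_mem _
  | add A B _ _ hA hB => rw [map_add]; exact add_mem hA hB
  | smul c A hA' hA =>
    rw [leftD_smul]
    exact add_mem (Submodule.smul_mem _ _ hA') (Submodule.smul_mem _ _ hA)

/-- A fixed tuple of local functions is annihilated by all operators of large vertical degree. -/
theorem exists_forall_opFilt_apply_eq_zero (f : Fin n → Loc N) :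
    ∃ K, ∀ d, K < d → ∀ A ∈ opFilt N n d, A f = 0 := by
  choose k hk using fun j => exists_jetOrder (f j)
  refine ⟨∑ j, k j, fun d hd A hA => ?_⟩
  induction hA using Submodule.span_induction with
  | mem A h =>
    obtain ⟨κ, hκ, rfl⟩ := h
    obtain ⟨j, -, hj⟩ := Finset.exists_lt_of_sum_lt (lt_of_lt_of_le hd hκ)
    rw [mono_apply]
    exact Finset.prod_eq_zero (Finset.mem_univ j) (by rw [partialPow_eq_zero (hk j) hj, map_zero])
  | zero => rfl
  | add A B _ _ hA hB => rw [add_apply, hA, hB, add_zero]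
  | smul c A _ hA => rw [smul_apply, hA, smul_zero]

theorem multiOp_sub_mem {Q : Submodule ℝ (MultiOp N n)} {A B : MultiOp N n} (hA : A ∈ Q)
    (hB : B ∈ Q) : A - B ∈ Q := by
  have : A - B = A + (-1 : ℝ) • B := by
    ext f : 1
    simp [sub_eq_add_neg]
  rw [this]
  exact add_mem hA (Submodule.smul_mem _ _ hB)

/-! ### Precomposition with total derivatives -/

/-- Unary operators spanned by the `(d/dx)^I (∂/∂u)^α` with `deg_f(α) ≥ d`. -/
def unaryFilt (N d : ℕ) : Submodule ℝ (Module.End ℝ (Loc N)) :=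
  Submodule.span ℝ {w | ∃ (I : MIdx N) (α : VIdx N), d ≤ degF α ∧ w = totalPow I * partialPow α}

theorem unaryFilt_anti {d e : ℕ} (h : d ≤ e) : unaryFilt N e ≤ unaryFilt N d :=
  Submodule.span_mono fun _ ⟨I, α, hα, hw⟩ => ⟨I, α, h.trans hα, hw⟩

theorem mul_partialU_mem_unaryFilt {d : ℕ} {w : Module.End ℝ (Loc N)} (hw : w ∈ unaryFilt N d)
    (J : MIdx N) : w * partialU J ∈ unaryFilt N (max d (order J)) := by
  induction hw using Submodule.span_induction with
  | mem w h =>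
    obtain ⟨I, α, hα, rfl⟩ := h
    rw [mul_assoc, ← partialPow_add_single]
    exact Submodule.subset_span ⟨I, _, by rw [degF_add_single]; exact max_le_max hα le_rfl, rfl⟩
  | zero => rw [zero_mul]; exact zero_mem _
  | add v w _ _ hv hw => rw [add_mul]; exact add_mem hv hw
  | smul c w _ hw => rw [smul_mul_assoc]; exact Submodule.smul_mem _ _ hw

theorem totalPow_mul_mem_unaryFilt {d : ℕ} {w : Module.End ℝ (Loc N)} (hw : w ∈ unaryFilt N d)
    (I : MIdx N) : totalPow I * w ∈ unaryFilt N d := by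
  induction hw using Submodule.span_induction with
  | mem w h =>
    obtain ⟨I', α, hα, rfl⟩ := h
    induction I using MIdx.raise_induction with
    | h0 => rw [totalPow_zero, one_mul]; exact Submodule.subset_span ⟨I', α, hα, rfl⟩
    | hs i I _ =>
      refine Submodule.subset_span ⟨raise i I + I', α, hα, ?_⟩
      rw [← mul_assoc]
      congr 1
      have : ∀ I : MIdx N, totalPow (I + I') = totalPow I * totalPow I' := by
        intro I
        induction I using MIdx.raise_induction with
        | h0 => simp [totalPow_zero]
        | hs i I ih =>
          have : raise i I + I' = raise i (I + I') := by unfold raise; abel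
          rw [this, totalPow_raise, totalPow_raise, ih, mul_assoc]
      rw [this]
  | zero => rw [mul_zero]; exact zero_mem _
  | add v w _ _ hv hw => rw [mul_add]; exact add_mem hv hw
  | smul c w _ hw => rw [mul_smul_comm]; exact Submodule.smul_mem _ _ hw

/-- Moving a total derivative to the left of vertical derivatives lowers the vertical degree by at
most one. -/
theorem partialPow_mul_totalD_mem (α : VIdx N) (i : Fin N) :
    partialPow α * totalD i ∈ unaryFilt N (degF α - 1) := by
  have hmem : ∀ β : VIdx N, partialPow β ∈ unaryFilt N (degF β) := fun β =>
    Submodule.subset_span ⟨0, β, le_rfl, by rw [totalPow_zero, one_mul]⟩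
  induction α using VIdx.single_induction with
  | h0 =>
    refine Submodule.subset_span ⟨raise i 0, 0, by simp [degF], ?_⟩
    rw [partialPow_zero, one_mul, mul_one, totalPow_raise, totalPow_zero, mul_one]
  | hs α J ih =>
    rw [degF_add_single, partialPow_add_single, mul_assoc]
    have h1 : partialPow α * totalD i * partialU J ∈ unaryFilt N (max (degF α) (order J) - 1) :=
      unaryFilt_anti (by omega) (mul_partialU_mem_unaryFilt ih J)
    by_cases hJ : J i = 0
    · have : partialU J * totalD i = totalD i * partialU J :=
        LinearMap.ext fun f => partialU_totalD_of_eq_zero hJ f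
      rw [this, ← mul_assoc]
      exact h1
    · obtain ⟨K, rfl⟩ := exists_raise hJ
      have : partialU (raise i K) * totalD i = totalD i * partialU (raise i K) + partialU K :=
        LinearMap.ext fun f => partialU_raise_totalD i K f
      rw [this, mul_add, ← mul_assoc]
      refine add_mem h1 (unaryFilt_anti ?_ (mul_partialU_mem_unaryFilt (hmem α) K))
      rw [order_raise]
      omega

theorem opProd_update_mem_opFilt {k d : ℕ} (κ : Idx N n) (j : Fin n)
    (hk : k ≤ d + ∑ l ∈ Finset.univ.erase j, degF (κ.α l)) {v : Module.End ℝ (Loc N)}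
    (hv : v ∈ unaryFilt N d) :
    opProd (Function.update (fun l => totalPow (κ.I l) * partialPow (κ.α l)) j v) ∈
      opFilt N n k := by
  have hlin : ∀ (w : Fin n → Module.End ℝ (Loc N)) (v : Module.End ℝ (Loc N)) (f : Fin n → Loc N),
      opProd (Function.update w j v) f = v (f j) * ∏ l ∈ Finset.univ.erase j, w l (f l) := by
    intro w v f
    rw [opProd_apply, ← Finset.mul_prod_erase _ _ (Finset.mem_univ j), Function.update_self]
    congr 1
    exact Finset.prod_congr rfl fun l hl => by rw [Function.update_of_ne (Finset.ne_of_mem_erase hl)]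
  induction hv using Submodule.span_induction with
  | mem v h =>
    obtain ⟨I, β, hβ, rfl⟩ := h
    have : opProd (Function.update (fun l => totalPow (κ.I l) * partialPow (κ.α l)) j
        (totalPow I * partialPow β)) =
        mono ⟨Function.update κ.I j I, Function.update κ.α j β⟩ := by
      unfold mono
      congr 1
      funext l
      by_cases h : l = j
      · subst h; simp
      · simp [h]
    rw [this]
    refine mono_mem_opFilt (hk.trans ?_)
    rw [Idx.deg, ← Finset.add_sum_erase _ _ (Finset.mem_univ j)]
    refine add_le_add (by simpa using hβ) (le_of_eq (Finset.sum_congr rfl fun l hl => ?_))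
    simp [Finset.ne_of_mem_erase hl]
  | zero =>
    convert zero_mem (opFilt N n k)
    ext f : 1
    rw [hlin]; simp
  | add v w _ _ hv hw =>
    convert add_mem hv hw using 1
    ext f : 1
    rw [add_apply, hlin, hlin, hlin, LinearMap.add_apply, add_mul]
  | smul c v _ hv =>
    convert smul_real_mem c hv using 1
    ext f : 1
    rw [smul_apply, hlin, hlin, LinearMap.smul_apply, smul_mul_assoc]

theorem compD_mem_opFilt (i : Fin N) (j : Fin n) {k : ℕ} {A : MultiOp N n}
    (hA : A ∈ opFilt N n k) : compD i j A ∈ opFilt N n (k - 1) := by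
  induction hA using Submodule.span_induction with
  | mem A h =>
    obtain ⟨κ, hκ, rfl⟩ := h
    have : compD i j (mono κ) = opProd (Function.update
        (fun l => totalPow (κ.I l) * partialPow (κ.α l)) j
        (totalPow (κ.I j) * (partialPow (κ.α j) * totalD i))) := by
      ext f : 1
      rw [compD_apply, mono_apply, opProd_apply]
      refine Finset.prod_congr rfl fun l _ => ?_
      by_cases h : l = j
      · subst h; simp
      · simp [h]
    rw [this]
    refine opProd_update_mem_opFilt κ j ?_
      (totalPow_mul_mem_unaryFilt (partialPow_mul_totalD_mem (κ.α j) i) _)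
    have : κ.deg = _ := (Finset.add_sum_erase _ _ (Finset.mem_univ j)).symm
    have hκ' : k ≤ κ.deg := hκ
    omega
  | zero => rw [map_zero]; exact zero_mem _
  | add A B _ _ hA hB => rw [map_add]; exact add_mem hA hB
  | smul c A _ hA => rw [compD_smul]; exact Submodule.smul_mem _ _ hA

/-! ### Operators without derivatives in the distinguished variable -/

variable [NeZero n]

/-- Finite sums, over `Loc(E)`, of monomial operators of vertical degree at least `k` without total
derivatives in the first slot. -/
def kerFilt (N n k : ℕ) [NeZero n] : Submodule (Loc N) (MultiOp N n) :=
  Submodule.span _ (mono '' {κ | k ≤ κ.deg ∧ κ.I 0 = 0})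

theorem mono_mem_kerFilt {k : ℕ} {κ : Idx N n} (h : k ≤ κ.deg) (h0 : κ.I 0 = 0) :
    mono κ ∈ kerFilt N n k :=
  Submodule.subset_span ⟨κ, ⟨h, h0⟩, rfl⟩

theorem kerFilt_le_opFilt (k : ℕ) : kerFilt N n k ≤ opFilt N n k :=
  Submodule.span_mono (Set.image_mono fun _ h => h.1)

/-- Operators in `kerFilt` are linear over the coordinates `x^i` in the first slot. -/
theorem kerFilt_coordX_mul {k : ℕ} {A : MultiOp N n} (hA : A ∈ kerFilt N n k) (i : Fin N)
    (f : Fin n → Loc N) : A (Function.update f 0 (coordX i * f 0)) = coordX i * A f := by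
  induction hA using Submodule.span_induction with
  | mem A h =>
    obtain ⟨κ, ⟨-, hκ⟩, rfl⟩ := h
    rw [mono_apply, mono_apply, ← Finset.mul_prod_erase _ _ (Finset.mem_univ 0),
      ← Finset.mul_prod_erase (a := 0) _ (fun j => totalPow (κ.I j) (partialPow (κ.α j) (f j)))
        (Finset.mem_univ _), Function.update_self, hκ, totalPow_zero]
    simp only [Module.End.one_apply, partialPow_coordX_mul, mul_assoc]
    congr 2
    exact Finset.prod_congr rfl fun l hl => by rw [Function.update_of_ne (Finset.ne_of_mem_erase hl)]
  | zero => simp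
  | add A B _ _ hA hB => rw [add_apply, hA, hB, add_apply, mul_add]
  | smul c A _ hA =>
    rw [smul_apply, hA, smul_apply, smul_eq_mul, smul_eq_mul,
      mul_left_comm]

/-- All operators are generated from those without derivatives in the first slot by composition
with total derivatives on the left: by the Leibniz rule a derivative in the first slot is a
derivative of the value minus derivatives in the other slots. -/
theorem opFilt_le {k : ℕ} {Q : Submodule ℝ (MultiOp N n)} (h0 : ∀ A ∈ kerFilt N n k, A ∈ Q)
    (hD : ∀ i, ∀ A ∈ Q, leftD i A ∈ Q) {A : MultiOp N n} (hA : A ∈ opFilt N n k) : A ∈ Q := by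
  have key : ∀ m : ℕ, ∀ κ : Idx N n, k ≤ κ.deg → order (κ.I 0) = m → ∀ c : Loc N,
      c • mono κ ∈ Q := by
    intro m
    induction m with
    | zero =>
      intro κ hκ h c
      refine h0 _ (Submodule.smul_mem _ _ (mono_mem_kerFilt hκ ?_))
      funext i
      exact (Finset.sum_eq_zero_iff.1 h) i (Finset.mem_univ i)
    | succ m ih =>
      intro κ hκ h c
      obtain ⟨i, hi⟩ : ∃ i, κ.I 0 i ≠ 0 := by
        by_contra! h'
        simp [order, h'] at h
      obtain ⟨K, hK⟩ := exists_raise hi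
      set κ' : Idx N n := ⟨Function.update κ.I 0 K, κ.α⟩ with hκ'
      have e : κ = κ'.raiseAt i 0 := by
        simp [κ', Idx.raiseAt, ← hK]
      have hm : order K = m := by rw [hK, order_raise] at h; omega
      have h1 := leftD_mono i κ'
      rw [← Finset.add_sum_erase _ _ (Finset.mem_univ 0), ← e] at h1
      have h2 : c • mono κ = leftD i (c • mono κ') - totalD i c • mono κ' -
          ∑ j ∈ Finset.univ.erase 0, c • mono (κ'.raiseAt i j) := by
        rw [leftD_smul, h1, smul_add, Finset.smul_sum]
        abel
      have hκ0 : order (κ'.I 0) = m := by simpa [κ'] using hm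
      rw [h2]
      refine multiOp_sub_mem (multiOp_sub_mem (hD _ _ (ih κ' hκ hκ0 c)) (ih κ' hκ hκ0 _)) (sum_mem fun j hj => ?_)
      refine ih (κ'.raiseAt i j) hκ ?_ c
      simpa [Idx.raiseAt, (Finset.ne_of_mem_erase hj).symm] using hκ0
  rw [opFilt, Finsupp.mem_span_image_iff_linearCombination] at hA
  obtain ⟨c, hc, rfl⟩ := hA
  exact sum_mem fun κ hκ => key _ κ (hc hκ) rfl _

end

section

/-! ### Local differential operators as series of finite operators -/

variable {N n : ℕ}

/-- Regrouping the terms of an operator by vertical degree. Both sides are finite sums when the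
terms `G κ` of large degree vanish, as they do after evaluation at a fixed tuple of functions. -/
theorem finsum_coeffs_eq_finsum_seq {c : ℕ} {q : ℕ → Idx N n →₀ Loc N}
    (hq : ∀ d, ∀ κ ∈ (q d).support, d ≤ κ.deg + c) {p : Idx N n → Loc N}
    (hp : ∀ κ, p κ = ∑ d ∈ Finset.range (κ.deg + c + 1), q d κ)
    {V : Type*} [AddCommMonoid V] (G : Idx N n → Loc N →+ V) {K : ℕ}
    (hG : ∀ κ : Idx N n, K < κ.deg → ∀ a, G κ a = 0) :
    ∑ᶠ κ, G κ (p κ) = ∑ᶠ d, (q d).sum fun κ a => G κ a := by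
  classical
  -- `S` contains all indices which contribute in vertical degree at most `K`
  set S := (Finset.range (K + c + 1)).biUnion fun d => (q d).support with hS
  have hqd : ∀ d κ, κ.deg + c < d → q d κ = 0 := fun d κ h => by
    by_contra h'
    have := hq d κ (Finsupp.mem_support_iff.2 h')
    omega
  rw [finsum_eq_finsetSum_of_support_subset (s := S), finsum_eq_finsetSum_of_support_subset
    (s := Finset.range (K + c + 1))]
  · have h1 : ∀ d ∈ Finset.range (K + c + 1), ((q d).sum fun κ a => G κ a) =
        ∑ κ ∈ S, G κ (q d κ) := fun d hd =>
      Finsupp.sum_of_support_subset _ (Finset.subset_biUnion_of_mem (fun d => (q d).support) hd) _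
        fun κ _ => map_zero _
    rw [Finset.sum_congr rfl h1, Finset.sum_comm]
    refine Finset.sum_congr rfl fun κ _ => ?_
    by_cases hK : K < κ.deg
    · simp [hG κ hK]
    · rw [hp, map_sum]
      refine Finset.sum_subset (fun d hd => ?_) fun d _ hd => ?_
      · rw [Finset.mem_range] at hd ⊢; omega
      · rw [hqd d κ (by rw [Finset.mem_range] at hd; omega), map_zero]
  · intro d hd
    rw [Finset.mem_coe, Finset.mem_range]
    by_contra hdK
    refine hd (Finset.sum_eq_zero fun κ hκ => hG κ ?_ _)
    have := hq d κ hκ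
    omega
  · intro κ hκ
    have hK : ¬ K < κ.deg := fun h => hκ (hG κ h _)
    have hpκ : p κ ≠ 0 := fun h => hκ (by simp [h])
    rw [hp] at hpκ
    obtain ⟨d, hd, hd'⟩ := Finset.exists_ne_zero_of_sum_ne_zero hpκ
    rw [Finset.mem_coe, hS, Finset.mem_biUnion]
    refine ⟨d, ?_, Finsupp.mem_support_iff.2 hd'⟩
    rw [Finset.mem_range] at hd ⊢; omega

theorem finiteCoeffs_of_seq {c : ℕ} {q : ℕ → Idx N n →₀ Loc N} {p : Idx N n → Loc N}
    (hp : ∀ κ, p κ = ∑ d ∈ Finset.range (κ.deg + c + 1), q d κ) : FiniteCoeffs p := by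
  classical
  intro m
  refine ((Finset.range (m + c + 1)).biUnion fun d => (q d).support).finite_toSet.subset ?_
  rintro κ ⟨hm, hpκ⟩
  change κ.deg ≤ m at hm
  rw [hp] at hpκ
  obtain ⟨d, hd, hd'⟩ := Finset.exists_ne_zero_of_sum_ne_zero hpκ
  rw [Finset.mem_coe, Finset.mem_biUnion]
  refine ⟨d, ?_, Finsupp.mem_support_iff.2 hd'⟩
  rw [Finset.mem_range] at hd ⊢; omega

/-- A family satisfying the finiteness condition splits into its parts of fixed vertical degree, which
are finitely supported. -/
theorem FiniteCoeffs.exists_seq {p : Idx N n → Loc N} (hp : FiniteCoeffs p) :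
    ∃ q : ℕ → Idx N n →₀ Loc N, (∀ d, ∀ κ ∈ (q d).support, d ≤ κ.deg) ∧
      ∀ κ, p κ = ∑ d ∈ Finset.range (κ.deg + 0 + 1), q d κ := by
  classical
  have hfin : ∀ d, (Function.support fun κ : Idx N n => if κ.deg = d then p κ else 0).Finite := by
    intro d
    refine (hp d).subset fun κ hκ => ?_
    have hd : κ.deg = d := by
      by_contra h
      exact hκ (if_neg h)
    exact ⟨hd.le, fun h => hκ (by simp [h])⟩
  refine ⟨fun d => Finsupp.ofSupportFinite _ (hfin d), fun d κ hκ => ?_, fun κ => ?_⟩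
  · rw [Finsupp.mem_support_iff] at hκ
    by_contra h
    exact hκ (if_neg (by omega))
  · rw [Finset.sum_eq_single κ.deg]
    · exact (if_pos rfl).symm
    · exact fun d _ hd => if_neg hd.symm
    · intro h; exact absurd (Finset.mem_range.2 (by omega)) h

/-- A sequence of finite operators of increasing vertical degree. -/
def IsFiltered (B : ℕ → MultiOp N n) : Prop :=
  ∀ d, B d ∈ opFilt N n d

theorem finite_support_of_mem_opFilt {B : ℕ → MultiOp N n} {c : ℕ}
    (hB : ∀ d, B d ∈ opFilt N n (d - c)) (f : Fin n → Loc N) :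
    (Function.support fun d => B d f).Finite := by
  obtain ⟨K, hK⟩ := exists_forall_opFilt_apply_eq_zero f
  refine (Finset.range (K + c + 1)).finite_toSet.subset fun d hd => ?_
  rw [Finset.mem_coe, Finset.mem_range]
  by_contra h
  exact hd (hK (d - c) (by omega) _ (hB d))

theorem exists_mono_apply_eq_zero (f : Fin n → Loc N) :
    ∃ K, ∀ κ : Idx N n, K < κ.deg → mono κ f = 0 := by
  obtain ⟨K, hK⟩ := exists_forall_opFilt_apply_eq_zero f
  exact ⟨K, fun κ hκ => hK _ hκ _ (mono_mem_opFilt le_rfl)⟩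

/-- A series of finite operators of increasing vertical degree is a local differential operator. A
bounded loss `c` of degree, as caused by precomposition with total derivatives, is harmless. -/
theorem isLDO_of_seq (c : ℕ) {A : MultiOp N n} {B : ℕ → MultiOp N n}
    (hB : ∀ d, B d ∈ opFilt N n (d - c)) (hA : ∀ f, A f = ∑ᶠ d, B d f) : IsLDO A := by
  have h : ∀ d, ∃ q : Idx N n →₀ Loc N, (∀ κ ∈ q.support, d - c ≤ κ.deg) ∧
      Finsupp.linearCombination (Loc N) mono q = B d := fun d => by
    have := hB d
    rw [opFilt, Finsupp.mem_span_image_iff_linearCombination] at this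
    exact this
  choose q hq hqB using h
  refine ⟨_, finiteCoeffs_of_seq (c := c) (q := q) fun κ => rfl, fun f => ?_⟩
  obtain ⟨K, hK⟩ := exists_mono_apply_eq_zero f
  have key := finsum_coeffs_eq_finsum_seq (c := c) (q := q)
    (fun d κ hκ => by have := hq d κ hκ; omega) (fun κ => rfl)
    (fun κ => AddMonoidHom.mulRight (mono κ f)) (K := K)
    (fun κ hκ a => by simp [hK κ hκ])
  simp only [← mono_apply]
  rw [hA]
  refine Eq.trans (finsum_congr fun d => ?_) key.symm
  rw [← hqB, Finsupp.linearCombination_apply, Finsupp.sum, sum_apply]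
  rfl

theorem IsLDO.exists_seq {A : MultiOp N n} (hA : IsLDO A) :
    ∃ B : ℕ → MultiOp N n, IsFiltered B ∧ ∀ f, A f = ∑ᶠ d, B d f := by
  obtain ⟨p, hp, hAp⟩ := hA
  obtain ⟨q, hq, hpq⟩ := hp.exists_seq
  refine ⟨fun d => (q d).sum fun κ a => a • mono κ, fun d => ?_, fun f => ?_⟩
  · exact Submodule.sum_mem _ fun κ hκ =>
      Submodule.smul_mem _ _ (mono_mem_opFilt (hq d κ hκ))
  · obtain ⟨K, hK⟩ := exists_mono_apply_eq_zero f
    have key := finsum_coeffs_eq_finsum_seq (c := 0) (q := q) hq hpq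
      (fun κ => AddMonoidHom.mulRight (mono κ f)) (K := K)
      (fun κ hκ a => by simp [hK κ hκ])
    rw [hAp]
    simp only [← mono_apply]
    refine key.trans (finsum_congr fun d => ?_)
    rw [Finsupp.sum, Finsupp.sum, sum_apply]
    rfl

/-- The sum of a sequence of finite operators of increasing vertical degree. -/
theorem IsFiltered.exists_sum {B : ℕ → MultiOp N n} (hB : IsFiltered B) :
    ∃ A : MultiOp N n, ∀ f, A f = ∑ᶠ d, B d f := by
  have hfin := finite_support_of_mem_opFilt (c := 0) hB
  refine ⟨⟨fun f => ∑ᶠ d, B d f, fun f j x y => ?_, fun f j a x => ?_⟩, fun f => rfl⟩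
  · simp only [MultilinearMap.map_update_add]
    exact finsum_add_distrib (hfin _) (hfin _)
  · simp only [MultilinearMap.map_update_smul]
    exact (smul_finsum a _).symm

/-- The space of `n`-multilinear local differential operators. -/
def ldo (N n : ℕ) : Submodule ℝ (MultiOp N n) where
  carrier := {A | IsLDO A}
  zero_mem' := isLDO_of_seq 0 (B := fun _ => 0) (fun _ => zero_mem _) fun f => by simp
  add_mem' := by
    intro A A' hA hA'
    obtain ⟨B, hB, hAB⟩ := hA.exists_seq
    obtain ⟨B', hB', hAB'⟩ := hA'.exists_seq
    refine isLDO_of_seq 0 (B := fun d => B d + B' d) (fun d => add_mem (hB d) (hB' d)) fun f => ?_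
    rw [add_apply, hAB, hAB']
    exact (finsum_add_distrib (finite_support_of_mem_opFilt (c := 0) hB f)
      (finite_support_of_mem_opFilt (c := 0) hB' f)).symm
  smul_mem' := by
    intro a A hA
    obtain ⟨B, hB, hAB⟩ := hA.exists_seq
    refine isLDO_of_seq 0 (B := fun d => a • B d) (fun d => smul_real_mem a (hB d)) fun f => ?_
    rw [smul_apply, hAB]
    exact smul_finsum a _

theorem compD_mem_ldo (i : Fin N) (j : Fin n) {A : MultiOp N n} (hA : A ∈ ldo N n) :
    compD i j A ∈ ldo N n := by
  obtain ⟨B, hB, hAB⟩ := IsLDO.exists_seq hA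
  refine isLDO_of_seq 1 (B := fun d => compD i j (B d)) (fun d => compD_mem_opFilt i j (hB d))
    fun f => ?_
  rw [compD_apply, hAB]
  simp only [compD_apply]

end

section

/-! ### Composition with powers of total derivatives -/

variable {N n : ℕ}

/-- `(d/dx)^I ∘ A`. -/
def leftPow (I : MIdx N) : Module.End ℝ (MultiOp N n) where
  toFun A := (totalPow I).compMultilinearMap A
  map_add' A B := by ext f : 1; exact map_add (totalPow I) _ _
  map_smul' c A := by ext f : 1; exact map_smul (totalPow I) _ _

theorem leftPow_apply (I : MIdx N) (A : MultiOp N n) (f : Fin n → Loc N) :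
    leftPow I A f = totalPow I (A f) := rfl

theorem leftPow_zero (A : MultiOp N n) : leftPow 0 A = A := by
  ext f : 1
  rw [leftPow_apply, totalPow_zero]; rfl

theorem leftPow_raise (i : Fin N) (I : MIdx N) (A : MultiOp N n) :
    leftPow (raise i I) A = leftD i (leftPow I A) := by
  ext f : 1
  exact totalPow_raise_apply i I _

theorem leftPow_mem_opFilt (I : MIdx N) {k : ℕ} {A : MultiOp N n} (hA : A ∈ opFilt N n k) :
    leftPow I A ∈ opFilt N n k := by
  induction I using MIdx.raise_induction with
  | h0 => rwa [leftPow_zero]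
  | hs i I ih => rw [leftPow_raise]; exact leftD_mem_opFilt i ih

theorem compD_commute (i i' : Fin N) (j j' : Fin n) :
    Commute (compD i j : Module.End ℝ (MultiOp N n)) (compD i' j') := by
  apply LinearMap.ext
  intro A
  ext f : 1
  change compD i j (compD i' j' A) f = compD i' j' (compD i j A) f
  simp only [compD_apply]
  congr 1
  by_cases h : j = j'
  · subst h
    simp only [Function.update_self, Function.update_idem]
    congr 1
    exact LinearMap.congr_fun (totalD_commute i' i).eq (f j)
  · rw [Function.update_of_ne h, Function.update_of_ne (Ne.symm h), Function.update_comm h]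

theorem compY_commute (i i' : Fin N) :
    Commute (compY i : Module.End ℝ (MultiOp N n)) (compY i') :=
  Commute.sum_left _ _ _ fun _ _ => Commute.sum_right _ _ _ fun _ _ => compD_commute _ _ _ _

theorem compY_leftPow_mkPiAlgebra (i : Fin N) (I : MIdx N) :
    compY i (leftPow I (MultilinearMap.mkPiAlgebra ℝ (Fin n) (Loc N))) =
      leftPow (raise i I) (MultilinearMap.mkPiAlgebra ℝ (Fin n) (Loc N)) := by
  ext f : 1
  rw [leftPow_apply, totalPow_raise_apply', compY, LinearMap.sum_apply, sum_apply]
  simp only [compD_apply, leftPow_apply, MultilinearMap.mkPiAlgebra_apply]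
  rw [totalD_prod, map_sum]

/-! ### Families of operators indexed by powers of total derivatives -/

/-- The finite operator `∑_I (d/dx)^I ∘ X_I`. -/
def realize : (MIdx N →₀ MultiOp N n) →ₗ[ℝ] MultiOp N n :=
  Finsupp.lsum ℝ leftPow

theorem realize_apply (X : MIdx N →₀ MultiOp N n) (f : Fin n → Loc N) :
    realize X f = ∑ᶠ I, totalPow I (X I f) := by
  rw [realize, Finsupp.lsum_apply, Finsupp.sum, sum_apply]
  refine (finsum_eq_finsetSum_of_support_subset _ fun I hI => ?_).symm
  rw [Finset.mem_coe, Finsupp.mem_support_iff]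
  intro h
  exact hI (by simp [h])

/-- The normal family of `d/dx^i ∘ A`, for `R` the normal family of `A`. -/
def shift (i : Fin N) (R : MIdx N → MultiOp N n) (J : MIdx N) : MultiOp N n :=
  (if J i = 0 then 0 else 1 : ℝ) • R (J - Pi.single i 1)

theorem shift_raise (i : Fin N) (R : MIdx N → MultiOp N n) (J : MIdx N) :
    shift i R (raise i J) = R J := by
  have h : raise i J - Pi.single i 1 = J := by unfold raise; exact add_tsub_cancel_right _ _
  have h1 : raise i J i ≠ 0 := by simp [raise]
  rw [shift, if_neg h1, h, one_smul]

theorem shift_of_eq_zero {i : Fin N} {J : MIdx N} (h : J i = 0) (R : MIdx N → MultiOp N n) :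
    shift i R J = 0 := by
  rw [shift, if_pos h, zero_smul]

/-! ### Polarized monomials -/

variable [NeZero n]

/-- The index with the total derivatives of the first slot removed. -/
def Idx.base (κ : Idx N n) : Idx N n := ⟨Function.update κ.I 0 0, κ.α⟩

theorem Idx.base_base (κ : Idx N n) : κ.base.base = κ.base := by
  simp [Idx.base]

theorem mono_base_mem_kerFilt {k : ℕ} {κ : Idx N n} (h : k ≤ κ.deg) :
    mono κ.base ∈ kerFilt N n k :=
  mono_mem_kerFilt (κ := κ.base) h (by simp [Idx.base])

/-- By the Leibniz rule, a power of `d/dy_1` is a total derivative of the value. -/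
theorem polMonomial_eq (κ : Idx N n) : polMonomial κ = leftPow (κ.I 0) (mono κ.base) := by
  have h : ∀ I : MIdx N, (List.ofFn fun i => compY i ^ I i).prod
      (MultilinearMap.mkPiAlgebra ℝ (Fin n) (Loc N)) =
        leftPow I (MultilinearMap.mkPiAlgebra ℝ (Fin n) (Loc N)) := by
    intro I
    induction I using MIdx.raise_induction with
    | h0 => rw [leftPow_zero]; simp
    | hs i I ih =>
      rw [prod_ofFn_pow_update _ compY_commute, Module.End.mul_apply, ih,
        compY_leftPow_mkPiAlgebra]
  ext f : 1
  rw [polMonomial, h, leftPow_apply, mono_apply]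
  change totalPow _ (MultilinearMap.mkPiAlgebra ℝ (Fin n) (Loc N) _) = _
  rw [MultilinearMap.mkPiAlgebra_apply]
  congr 1
  refine Finset.prod_congr rfl fun j _ => ?_
  by_cases hj : j = 0
  · subst hj
    simp [Idx.base, totalPow_zero]
  · simp [Idx.base, hj]

/-! ### Normal forms -/

/-- Pairs `(∑_I (d/dx)^I ∘ X_I, X_0)` with finitely many nonzero coefficients `X_I` in
`kerFilt N n k`. -/
def normalPairs (N n k : ℕ) [NeZero n] : Submodule ℝ (MultiOp N n × MultiOp N n) where
  carrier := {y | ∃ X : MIdx N →₀ MultiOp N n, (∀ I, X I ∈ kerFilt N n k) ∧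
    realize X = y.1 ∧ X 0 = y.2}
  zero_mem' := ⟨0, fun _ => zero_mem _, map_zero _, rfl⟩
  add_mem' := by
    rintro _ _ ⟨X, hX, h1, h2⟩ ⟨Y, hY, h3, h4⟩
    exact ⟨X + Y, fun I => add_mem (hX I) (hY I), by rw [map_add, h1, h3]; rfl,
      by rw [Finsupp.add_apply, h2, h4]; rfl⟩
  smul_mem' := by
    rintro c _ ⟨X, hX, h1, h2⟩
    exact ⟨c • X, fun I => smul_real_mem c (hX I), by rw [map_smul, h1]; rfl,
      by rw [Finsupp.smul_apply, h2]; rfl⟩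

theorem diag_mem_normalPairs {k : ℕ} {A : MultiOp N n} (hA : A ∈ kerFilt N n k) :
    (A, A) ∈ normalPairs N n k := by
  classical
  refine ⟨Finsupp.single 0 A, fun I => ?_, ?_, Finsupp.single_eq_same⟩
  · rw [Finsupp.single_apply]
    split_ifs
    exacts [hA, zero_mem _]
  · simp [realize, leftPow_zero]

theorem leftD_mem_normalPairs (i : Fin N) {k : ℕ} {A X : MultiOp N n}
    (h : (A, X) ∈ normalPairs N n k) : (leftD i A, 0) ∈ normalPairs N n k := by
  obtain ⟨Y, hY, rfl, -⟩ := h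
  have h0 : ∀ J : MIdx N, J i = 0 → J ∉ Set.range (raise i) := by
    rintro _ h ⟨J, rfl⟩
    simp [raise] at h
  refine ⟨Y.mapDomain (raise i), fun J => ?_, ?_, Finsupp.mapDomain_of_notMem_range _ _ (h0 0 rfl)⟩
  · by_cases hJ : J i = 0
    · rw [Finsupp.mapDomain_of_notMem_range _ _ (h0 J hJ)]
      exact zero_mem _
    · obtain ⟨K, rfl⟩ := exists_raise hJ
      rw [Finsupp.mapDomain_apply (raise_injective i)]
      exact hY K
  · simp only [realize, Finsupp.lsum_apply]
    rw [Finsupp.sum_mapDomain_index (fun _ => map_zero _) (fun _ _ _ => map_add _ _ _),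
      Finsupp.sum, Finsupp.sum, map_sum]
    simp only [leftPow_raise]

/-- The characteristic of `c (d/dx)^I ∘ A` is `((-d/dx)^I c) A`. -/
theorem smul_leftPow_mem_normalPairs {k : ℕ} {A : MultiOp N n} (hA : A ∈ kerFilt N n k)
    (I : MIdx N) (c : Loc N) :
    (c • leftPow I A, ((-1) ^ order I * totalPow I c) • A) ∈ normalPairs N n k := by
  induction I using MIdx.raise_induction generalizing c with
  | h0 =>
    simpa [leftPow_zero, order_zero, totalPow_zero] using
      diag_mem_normalPairs (Submodule.smul_mem _ c hA)
  | hs i I ih =>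
    have h := add_mem (leftD_mem_normalPairs i (ih c))
      (Submodule.smul_mem _ (-1 : ℝ) (ih (totalD i c)))
    convert h using 1
    refine Prod.ext ?_ ?_
    · ext f : 1
      simp [leftPow_raise, leftD_smul]
    · ext f : 1
      simp [order_raise, totalPow_raise_apply', pow_succ]
      ring

theorem exists_mem_normalPairs {k : ℕ} {A : MultiOp N n} (hA : A ∈ opFilt N n k) :
    ∃ X, (A, X) ∈ normalPairs N n k := by
  have : A ∈ (normalPairs N n k).map (LinearMap.fst ℝ (MultiOp N n) (MultiOp N n)) := by
    refine opFilt_le (k := k) (fun A hA => ?_) (fun i A hA => ?_) hA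
    · exact Submodule.mem_map.2 ⟨(A, A), diag_mem_normalPairs hA, rfl⟩
    · obtain ⟨⟨A', X⟩, h, rfl⟩ := Submodule.mem_map.1 hA
      exact Submodule.mem_map.2 ⟨_, leftD_mem_normalPairs i h, rfl⟩
  obtain ⟨⟨A', X⟩, h, rfl⟩ := Submodule.mem_map.1 this
  exact ⟨X, h⟩

/-- A family `R_I` of operators which is a series of finite families of operators in `kerFilt` of
increasing vertical degree. -/
def IsNormal (R : MIdx N → MultiOp N n) : Prop :=
  ∃ B : ℕ → MIdx N →₀ MultiOp N n, (∀ d I, B d I ∈ kerFilt N n d) ∧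
    ∀ I f, R I f = ∑ᶠ d, B d I f

theorem IsNormal.finite_support {R : MIdx N → MultiOp N n} (hR : IsNormal R)
    (f : Fin n → Loc N) : (Function.support fun I => R I f).Finite := by
  classical
  obtain ⟨B, hB, hRB⟩ := hR
  obtain ⟨K, hK⟩ := exists_forall_opFilt_apply_eq_zero f
  refine ((Finset.range (K + 1)).biUnion fun d => (B d).support).finite_toSet.subset
    fun I hI => ?_
  by_contra h
  refine hI ?_
  change R I f = 0
  rw [hRB]
  refine (finsum_congr fun d => ?_).trans finsum_zero
  by_cases hd : K < d
  · exact hK d hd _ (kerFilt_le_opFilt _ (hB d I))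
  · have : B d I = 0 := by
      by_contra h'
      exact h (Finset.mem_coe.2 (Finset.mem_biUnion.2
        ⟨d, Finset.mem_range.2 (by omega), Finsupp.mem_support_iff.2 h'⟩))
    rw [this]; rfl

theorem IsNormal.coordX_mul {R : MIdx N → MultiOp N n} (hR : IsNormal R) (I : MIdx N) (i : Fin N)
    (f : Fin n → Loc N) : R I (Function.update f 0 (coordX i * f 0)) = coordX i * R I f := by
  obtain ⟨B, hB, hRB⟩ := hR
  rw [hRB, hRB]
  have hfin := finite_support_of_mem_opFilt (c := 0) (B := fun d => B d I)
    (fun d => kerFilt_le_opFilt _ (hB d I)) f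
  change _ = (AddMonoidHom.mulLeft (coordX i)) _
  rw [map_finsum _ hfin]
  exact finsum_congr fun d => kerFilt_coordX_mul (hB d I) i f

theorem IsNormal.add {R R' : MIdx N → MultiOp N n} (hR : IsNormal R) (hR' : IsNormal R') :
    IsNormal (R + R') := by
  obtain ⟨B, hB, hRB⟩ := hR
  obtain ⟨B', hB', hRB'⟩ := hR'
  refine ⟨fun d => B d + B' d, fun d I => add_mem (hB d I) (hB' d I), fun I f => ?_⟩
  rw [Pi.add_apply, add_apply, hRB, hRB']
  exact (finsum_add_distrib (finite_support_of_mem_opFilt (c := 0) (B := fun d => B d I)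
    (fun d => kerFilt_le_opFilt _ (hB d I)) f) (finite_support_of_mem_opFilt (c := 0)
      (B := fun d => B' d I) (fun d => kerFilt_le_opFilt _ (hB' d I)) f)).symm

/-- Normal families are stable under rescaling and reindexing with finite fibres. -/
theorem IsNormal.reindex {R : MIdx N → MultiOp N n} (hR : IsNormal R) (c : MIdx N → ℝ)
    (g : MIdx N → MIdx N) (hg : Set.InjOn g {I | c I ≠ 0}) :
    IsNormal fun I => c I • R (g I) := by
  obtain ⟨B, hB, hRB⟩ := hR
  have hfin : ∀ d, (Function.support fun I => c I • B d (g I)).Finite := fun d => by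
    refine Set.Finite.of_injOn (f := g) (t := (B d).support) (fun I hI => ?_)
      (hg.mono fun I hI => ?_) (B d).support.finite_toSet
    · rw [Finset.mem_coe, Finsupp.mem_support_iff]
      exact fun h => hI (by simp [h])
    · rw [Set.mem_ofPred_eq]
      exact fun h => hI (by simp [h])
  refine ⟨fun d => Finsupp.ofSupportFinite _ (hfin d), fun d I => smul_real_mem _ (hB d _),
    fun I f => ?_⟩
  change c I • R (g I) f = ∑ᶠ d, c I • B d (g I) f
  rw [hRB, smul_finsum]

theorem IsNormal.finite_support_totalPow {R : MIdx N → MultiOp N n} (hR : IsNormal R)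
    (f : Fin n → Loc N) : (Function.support fun I => totalPow I (R I f)).Finite := by
  refine (hR.finite_support f).subset fun I hI => ?_
  rw [Function.mem_support] at hI ⊢
  exact fun h => hI (by rw [h, map_zero])

/-- The relation `A = ∑_I (d/dx)^I ∘ R_I` between operators and normal families. -/
def normalForms (N n : ℕ) [NeZero n] : Submodule ℝ ((MIdx N → MultiOp N n) × MultiOp N n) where
  carrier := {y | IsNormal y.1 ∧ ∀ f, y.2 f = ∑ᶠ I, totalPow I (y.1 I f)}
  zero_mem' := ⟨⟨fun _ => 0, fun _ _ => zero_mem _, fun I f => by simp⟩, fun f => by simp⟩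
  add_mem' := by
    rintro ⟨R, A⟩ ⟨R', A'⟩ ⟨hR, hA⟩ ⟨hR', hA'⟩
    refine ⟨hR.add hR', fun f => ?_⟩
    dsimp only at hA hA' ⊢
    rw [Prod.snd_add, Prod.fst_add, add_apply, hA, hA', ← finsum_add_distrib (hR.finite_support_totalPow f)
      (hR'.finite_support_totalPow f)]
    exact finsum_congr fun I => (map_add _ _ _).symm
  smul_mem' := by
    rintro c ⟨R, A⟩ ⟨hR, hA⟩
    refine ⟨hR.reindex (fun _ => c) id (fun _ _ _ _ h => h), fun f => ?_⟩
    dsimp only at hA ⊢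
    rw [Prod.smul_snd, smul_apply, hA, smul_finsum]
    exact finsum_congr fun I => (map_smul (totalPow I) _ _).symm

/-- Summation over total derivatives and over vertical degree may be interchanged. -/
theorem finsum_realize {B : ℕ → MIdx N →₀ MultiOp N n} (hB : ∀ d I, B d I ∈ kerFilt N n d)
    (f : Fin n → Loc N) :
    ∑ᶠ I, totalPow I (∑ᶠ d, B d I f) = ∑ᶠ d, realize (B d) f := by
  classical
  obtain ⟨K, hK⟩ := exists_forall_opFilt_apply_eq_zero f
  have hK' : ∀ d I, K < d → B d I f = 0 := fun d I hd => hK d hd _ (kerFilt_le_opFilt _ (hB d I))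
  set S := (Finset.range (K + 1)).biUnion fun d => (B d).support with hS
  have hBS : ∀ d I, I ∉ S → B d I f = 0 := fun d I hI => by
    by_cases hd : K < d
    · exact hK' d I hd
    · have : B d I = 0 := by
        by_contra h'
        exact hI (Finset.mem_biUnion.2
          ⟨d, Finset.mem_range.2 (by omega), Finsupp.mem_support_iff.2 h'⟩)
      rw [this]; rfl
  have h1 : ∀ I, ∑ᶠ d, B d I f = ∑ d ∈ Finset.range (K + 1), B d I f := fun I =>
    finsum_eq_finsetSum_of_support_subset _ fun d hd => by
      rw [Finset.mem_coe, Finset.mem_range]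
      by_contra h
      exact hd (hK' d I (by omega))
  have h2 : ∀ d, realize (B d) f = ∑ I ∈ S, totalPow I (B d I f) := fun d => by
    rw [realize_apply]
    exact finsum_eq_finsetSum_of_support_subset _ fun I hI => by
      by_contra h
      exact hI (by simp [hBS d I h])
  rw [finsum_eq_finsetSum_of_support_subset (s := S), finsum_eq_finsetSum_of_support_subset
    (s := Finset.range (K + 1))]
  · simp only [h1, h2, map_sum]
    exact Finset.sum_comm
  · intro d hd
    rw [Finset.mem_coe, Finset.mem_range]
    by_contra h
    exact hd (by
      change realize (B d) f = 0
      rw [h2]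
      exact Finset.sum_eq_zero fun I _ => by rw [hK' d I (by omega), map_zero])
  · intro I hI
    by_contra h
    exact hI (by
      change totalPow I _ = 0
      rw [finsum_congr fun d => hBS d I h, finsum_zero, map_zero])

theorem realize_mem_opFilt {k : ℕ} {X : MIdx N →₀ MultiOp N n} (hX : ∀ I, X I ∈ kerFilt N n k) :
    realize X ∈ opFilt N n k := by
  rw [realize, Finsupp.lsum_apply]
  exact Submodule.sum_mem _ fun I _ => leftPow_mem_opFilt I (kerFilt_le_opFilt _ (hX I))

theorem mem_ldo_of_normalForms {R : MIdx N → MultiOp N n} {A : MultiOp N n}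
    (h : (R, A) ∈ normalForms N n) : A ∈ ldo N n := by
  obtain ⟨⟨B, hB, hRB⟩, hA⟩ := h
  refine isLDO_of_seq 0 (B := fun d => realize (B d)) (fun d => realize_mem_opFilt (hB d))
    fun f => ?_
  rw [← finsum_realize hB]
  simp only [← hRB]
  exact hA f

theorem IsNormal.exists_normalForms {R : MIdx N → MultiOp N n} (h : IsNormal R) :
    ∃ A, (R, A) ∈ normalForms N n := by
  obtain ⟨B, hB, hRB⟩ := h
  obtain ⟨A, hA⟩ := IsFiltered.exists_sum (B := fun d => realize (B d))
    fun d => realize_mem_opFilt (hB d)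
  refine ⟨A, ⟨B, hB, hRB⟩, fun f => ?_⟩
  rw [hA, ← finsum_realize hB]
  simp only [hRB]

/-- Finite normal forms of increasing vertical degree add up to a normal form, whose constant
coefficient is the sum of the constant coefficients. -/
theorem exists_normalForms_of_pairs {A X : ℕ → MultiOp N n}
    (h : ∀ d, (A d, X d) ∈ normalPairs N n d) {T : MultiOp N n} (hT : ∀ f, T f = ∑ᶠ d, A d f) :
    ∃ R, (R, T) ∈ normalForms N n ∧ ∀ f, R 0 f = ∑ᶠ d, X d f := by
  choose B hB hBA hBX using h
  choose R hR using fun I => IsFiltered.exists_sum (B := fun d => B d I)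
    fun d => kerFilt_le_opFilt _ (hB d I)
  refine ⟨R, ⟨⟨B, hB, hR⟩, fun f => ?_⟩, fun f => ?_⟩
  · simp only [hR]
    rw [finsum_realize hB, hT]
    simp only [hBA]
  · rw [hR]
    simp only [hBX]

/-- Every local differential operator has a normal form. -/
theorem exists_normalForms {A : MultiOp N n} (hA : A ∈ ldo N n) :
    ∃ R, (R, A) ∈ normalForms N n := by
  obtain ⟨B, hB, hAB⟩ := IsLDO.exists_seq hA
  choose X hX using fun d => exists_mem_normalPairs (hB d)
  obtain ⟨R, hR, -⟩ := exists_normalForms_of_pairs hX hAB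
  exact ⟨R, hR⟩

/-! ### Uniqueness of normal forms -/

theorem finsum_eq_finsum_raise (i : Fin N) {F : MIdx N → Loc N} (hF : ∀ J, J i = 0 → F J = 0) :
    ∑ᶠ J, F J = ∑ᶠ J, F (raise i J) := by
  rw [← finsum_mem_range (raise_injective i), ← finsum_mem_univ]
  refine finsum_mem_inter_support_eq' _ _ _ fun J hJ => ?_
  refine iff_of_true trivial ?_
  obtain ⟨K, rfl⟩ := exists_raise (i := i) (J := J) fun h => hJ (hF J h)
  exact ⟨K, rfl⟩

theorem shift_mem_normalForms (i : Fin N) {R : MIdx N → MultiOp N n} {A : MultiOp N n}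
    (h : (R, A) ∈ normalForms N n) : (shift i R, leftD i A) ∈ normalForms N n := by
  obtain ⟨hR, hA⟩ := h
  refine ⟨hR.reindex _ _ fun J hJ K hK hJK => ?_, fun f => ?_⟩
  · obtain ⟨J, rfl⟩ := exists_raise (i := i) (J := J) fun h => hJ (if_pos h)
    obtain ⟨K, rfl⟩ := exists_raise (i := i) (J := K) fun h => hK (if_pos h)
    have : ∀ L : MIdx N, raise i L - Pi.single i 1 = L := fun L => by
      unfold raise; exact add_tsub_cancel_right _ _
    rw [this, this] at hJK
    rw [hJK]
  · dsimp only at hA ⊢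
    rw [leftD_apply, hA, map_finsum _ (hR.finite_support_totalPow f),
      finsum_eq_finsum_raise i (F := fun J => totalPow J (shift i R J f))
        fun J hJ => by rw [shift_of_eq_zero hJ, zero_apply, map_zero]]
    simp only [shift_raise, totalPow_raise_apply]

/-- The commutator of `∑_I (d/dx)^I ∘ R_I` with multiplication by `x^i`, in the first slot and on
the value, is `∑_I I^i (d/dx)^{I - e_i} ∘ R_I`. -/
theorem finsum_lower_eq {R : MIdx N → MultiOp N n} (hR : IsNormal R) (i : Fin N)
    (f : Fin n → Loc N) :
    ∑ᶠ J, totalPow J (((J i + 1 : ℕ) : ℝ) • R (raise i J) f) =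
      ∑ᶠ I, totalPow I (R I (Function.update f 0 (coordX i * f 0))) -
        coordX i * ∑ᶠ I, totalPow I (R I f) := by
  have h1 : coordX i * ∑ᶠ I, totalPow I (R I f) = ∑ᶠ I, coordX i * totalPow I (R I f) :=
    map_finsum (AddMonoidHom.mulLeft (coordX i)) (hR.finite_support_totalPow f)
  have h2 : (Function.support fun I => coordX i * totalPow I (R I f)).Finite :=
    (hR.finite_support_totalPow f).subset fun I hI => by
      rw [Function.mem_support] at hI ⊢
      exact fun h => hI (by rw [h, mul_zero])
  rw [h1, ← finsum_sub_distrib (hR.finite_support_totalPow _) h2]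
  simp only [hR.coordX_mul, totalPow_coordX_mul, add_sub_cancel_left]
  refine Eq.trans (finsum_congr fun J => ?_) (finsum_eq_finsum_raise i
    (F := fun I => (I i : ℝ) • totalPow (I - Pi.single i 1) (R I f))
    fun J hJ => by rw [hJ]; simp).symm
  have h : raise i J - Pi.single i 1 = J := by unfold raise; exact add_tsub_cancel_right _ _
  rw [h, map_smul]
  simp [raise]

/-- Uniqueness of normal forms. Commuting with the coordinates `x^i` lowers the order, so that the
coefficients are recovered by induction on the largest order present at a given tuple. -/
theorem eq_zero_of_normalForms {R : MIdx N → MultiOp N n} (h : (R, 0) ∈ normalForms N n) :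
    R = 0 := by
  suffices H : ∀ m : ℕ, ∀ R : MIdx N → MultiOp N n, (R, 0) ∈ normalForms N n → ∀ f,
      (∀ I, m < order I → R I f = 0) → ∀ I, R I f = 0 by
    funext I
    ext f : 1
    obtain ⟨m, hm⟩ := ((h.1.finite_support f).image order).bddAbove
    refine H m R h f (fun I hI => ?_) I
    by_contra hne
    exact absurd (hm ⟨I, hne, rfl⟩) (by omega)
  intro m
  induction m with
  | zero =>
    rintro R ⟨hR, h0⟩ f hf I
    have hz : ∀ J : MIdx N, J ≠ 0 → R J f = 0 := fun J hJ => hf J (by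
      by_contra h
      exact hJ (funext fun i => (Finset.sum_eq_zero_iff.1 (Nat.le_zero.1 (not_lt.1 h))) i
        (Finset.mem_univ i)))
    by_cases hI : I = 0
    · subst hI
      have := h0 f
      rw [finsum_eq_single _ 0 fun J hJ => by rw [hz J hJ, map_zero]] at this
      simpa [totalPow_zero] using this.symm
    · exact hz I hI
  | succ m ih =>
    intro R hR f hf I
    have hz : ∀ i J, R (raise i J) f = 0 := by
      intro i J
      have hlow : ((fun J => ((J i + 1 : ℕ) : ℝ) • R (raise i J)), (0 : MultiOp N n)) ∈
          normalForms N n := by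
        refine ⟨hR.1.reindex _ _ ((raise_injective i).injOn), fun g => ?_⟩
        have := finsum_lower_eq hR.1 i g
        rw [← hR.2, ← hR.2] at this
        simpa using this.symm
      have := ih _ hlow f (fun K hK => by
        rw [smul_apply, hf _ (by rw [order_raise]; omega), smul_zero]) J
      rw [smul_apply] at this
      exact (smul_eq_zero.1 this).resolve_left (Nat.cast_ne_zero.2 (Nat.succ_ne_zero _))
    refine ih R hR f (fun K hK => ?_) I
    obtain ⟨i, hi⟩ : ∃ i, K i ≠ 0 := by
      by_contra! h'
      simp [order, h'] at hK
    obtain ⟨L, rfl⟩ := exists_raise hi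
    exact hz i L

end

section

/-! ### The characteristic -/

variable {N n : ℕ}

/-- Evaluation at `f` of the terms of an operator, as additive maps of the coefficients. -/
def termAt (G : Idx N n → Loc N →ₗ[ℝ] MultiOp N n) (f : Fin n → Loc N) (κ : Idx N n) :
    Loc N →+ Loc N where
  toFun c := G κ c f
  map_zero' := by rw [map_zero]; rfl
  map_add' a b := by rw [map_add]; rfl

theorem sum_termAt (G : Idx N n → Loc N →ₗ[ℝ] MultiOp N n) (f : Fin n → Loc N)
    (q : Idx N n →₀ Loc N) :
    (q.sum fun κ a => termAt G f κ a) = (∑ κ ∈ q.support, G κ (q κ)) f := by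
  rw [Finsupp.sum, sum_apply]
  rfl

variable [NeZero n]

/-- The term `c (d/dy_1)^{I_1} ⋯ (∂/∂u_n)^{α_n}` of a polarized form. -/
def polTerm (κ : Idx N n) : Loc N →ₗ[ℝ] MultiOp N n where
  toFun c := c • polMonomial κ
  map_add' a b := add_smul a b _
  map_smul' r c := by
    ext f : 1
    exact smul_mul_assoc r c _

/-- The term `((-d/dx)^{I_1} c) (d/dy_2)^{I_2} ⋯ (∂/∂u_n)^{α_n}` of a characteristic. -/
def chiTerm (κ : Idx N n) : Loc N →ₗ[ℝ] MultiOp N n where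
  toFun c := ((-1) ^ order (κ.I 0) * totalPow (κ.I 0) c) • mono κ.base
  map_add' a b := by rw [map_add, mul_add, add_smul]
  map_smul' r c := by
    ext f : 1
    change ((-1) ^ order (κ.I 0) * totalPow (κ.I 0) (r • c)) * mono κ.base f =
      r • (((-1) ^ order (κ.I 0) * totalPow (κ.I 0) c) * mono κ.base f)
    rw [map_smul, mul_smul_comm, smul_mul_assoc]

theorem polTerm_apply (κ : Idx N n) (c : Loc N) : polTerm κ c = c • leftPow (κ.I 0) (mono κ.base) := by
  rw [← polMonomial_eq]; rfl

theorem chiTerm_apply (κ : Idx N n) (c : Loc N) :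
    chiTerm κ c = ((-1) ^ order (κ.I 0) * totalPow (κ.I 0) c) • mono κ.base := rfl

theorem polMonomial_base (κ : Idx N n) :
    polMonomial ⟨Function.update κ.I 0 0, κ.α⟩ = mono κ.base := by
  rw [polMonomial_eq]
  change leftPow (κ.base.I 0) (mono κ.base.base) = _
  rw [Idx.base_base]
  simp [Idx.base, leftPow_zero]

/-- The operator with finitely many prescribed polarized coefficients. -/
def polSum : (Idx N n →₀ Loc N) →ₗ[ℝ] MultiOp N n := Finsupp.lsum ℝ polTerm

/-- The characteristic of the operator with finitely many prescribed polarized coefficients. -/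
def chiSum : (Idx N n →₀ Loc N) →ₗ[ℝ] MultiOp N n := Finsupp.lsum ℝ chiTerm

theorem polSum_eq (q : Idx N n →₀ Loc N) : polSum q = ∑ κ ∈ q.support, polTerm κ (q κ) := rfl

theorem chiSum_eq (q : Idx N n →₀ Loc N) : chiSum q = ∑ κ ∈ q.support, chiTerm κ (q κ) := rfl

/-- Pairs consisting of a finite operator in polarized form, of vertical degree at least `k`, and
its characteristic. -/
def polPairs (N n k : ℕ) [NeZero n] : Submodule ℝ (MultiOp N n × MultiOp N n) where
  carrier := {y | ∃ q : Idx N n →₀ Loc N, (∀ κ, κ.deg < k → q κ = 0) ∧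
    polSum q = y.1 ∧ chiSum q = y.2}
  zero_mem' := ⟨0, fun _ _ => rfl, map_zero _, map_zero _⟩
  add_mem' := by
    rintro _ _ ⟨q, hq, h1, h2⟩ ⟨r, hr, h3, h4⟩
    exact ⟨q + r, fun κ hκ => by rw [Finsupp.add_apply, hq κ hκ, hr κ hκ, add_zero],
      by rw [map_add, h1, h3]; rfl, by rw [map_add, h2, h4]; rfl⟩
  smul_mem' := by
    rintro c _ ⟨q, hq, h1, h2⟩
    exact ⟨c • q, fun κ hκ => by rw [Finsupp.smul_apply, hq κ hκ, smul_zero],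
      by rw [map_smul, h1]; rfl, by rw [map_smul, h2]; rfl⟩

theorem term_mem_polPairs {k : ℕ} {κ : Idx N n} (hκ : k ≤ κ.deg) (c : Loc N) :
    (polTerm κ c, chiTerm κ c) ∈ polPairs N n k := by
  classical
  refine ⟨Finsupp.single κ c, fun κ' h => ?_, by simp [polSum], by simp [chiSum]⟩
  rw [Finsupp.single_apply, if_neg]
  rintro rfl
  omega

/-- Total derivatives have characteristic zero:
`d/dx^i ∘ (c (d/dy_1)^I P) = (dc/dx^i) (d/dy_1)^I P + c (d/dy_1)^{iI} P`, and the characteristics of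
the two terms cancel. -/
theorem leftD_polTerm_mem (i : Fin N) {k : ℕ} {κ : Idx N n} (hκ : k ≤ κ.deg) (c : Loc N) :
    (leftD i (polTerm κ c), 0) ∈ polPairs N n k := by
  set κ' : Idx N n := ⟨Function.update κ.I 0 (raise i (κ.I 0)), κ.α⟩ with hκ'
  have hb : κ'.base = κ.base := by simp [κ', Idx.base]
  have h0 : κ'.I 0 = raise i (κ.I 0) := by simp [κ']
  have h := add_mem (term_mem_polPairs hκ (totalD i c)) (term_mem_polPairs (κ := κ') hκ c)
  convert h using 1
  refine Prod.ext ?_ ?_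
  · simp only [Prod.fst_add, polTerm_apply, leftD_smul, hb, h0, leftPow_raise]
  · simp only [Prod.snd_add, chiTerm_apply, hb, h0, ← add_smul, order_raise,
      totalPow_raise_apply', pow_succ]
    ext f : 1
    simp only [zero_apply, smul_apply, smul_eq_mul]
    ring

theorem leftD_mem_polPairs (i : Fin N) {k : ℕ} {A X : MultiOp N n}
    (h : (A, X) ∈ polPairs N n k) : (leftD i A, 0) ∈ polPairs N n k := by
  obtain ⟨q, hq, rfl, -⟩ := h
  have h := Submodule.sum_mem (polPairs N n k) (t := q.support)
    (f := fun κ => (leftD i (polTerm κ (q κ)), 0)) fun κ hκ =>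
      leftD_polTerm_mem i (by
        by_contra h
        exact Finsupp.mem_support_iff.1 hκ (hq κ (by omega))) _
  convert h using 1
  refine Prod.ext ?_ ?_
  · rw [Prod.fst_sum, ← map_sum]; rfl
  · rw [Prod.snd_sum]; simp

theorem exists_mem_polPairs {k : ℕ} {A : MultiOp N n} (hA : A ∈ opFilt N n k) :
    ∃ X, (A, X) ∈ polPairs N n k := by
  have : A ∈ (polPairs N n k).map (LinearMap.fst ℝ (MultiOp N n) (MultiOp N n)) := by
    refine opFilt_le (k := k) (fun A hA => ?_) (fun i A hA => ?_) hA
    · rw [kerFilt, Finsupp.mem_span_image_iff_linearCombination] at hA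
      obtain ⟨c, hc, rfl⟩ := hA
      refine sum_mem fun κ hκ => Submodule.mem_map.2 ⟨_, term_mem_polPairs (hc hκ).1 (c κ), ?_⟩
      have h0 : κ.I 0 = 0 := (hc hκ).2
      have hb : κ.base = κ := by
        rw [Idx.base, ← h0, Function.update_eq_self]
      simp [polTerm_apply, h0, leftPow_zero, hb]
    · obtain ⟨⟨A', X⟩, h, rfl⟩ := Submodule.mem_map.1 hA
      exact Submodule.mem_map.2 ⟨_, leftD_mem_polPairs i h, rfl⟩
  obtain ⟨⟨A', X⟩, h, rfl⟩ := Submodule.mem_map.1 this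
  exact ⟨X, h⟩

theorem exists_term_apply_eq_zero (f : Fin n → Loc N) :
    ∃ K, ∀ κ : Idx N n, K < κ.deg → ∀ c, polTerm κ c f = 0 ∧ chiTerm κ c f = 0 := by
  obtain ⟨K, hK⟩ := exists_mono_apply_eq_zero f
  refine ⟨K, fun κ hκ c => ?_⟩
  rw [polTerm_apply, chiTerm_apply, smul_apply, smul_apply, leftPow_apply, hK κ.base hκ]
  simp

/-- The space of operators with a normal form whose constant coefficient vanishes. -/
def chiKer (N n : ℕ) [NeZero n] : Submodule ℝ (MultiOp N n) where
  carrier := {A | ∃ R, (R, A) ∈ normalForms N n ∧ R 0 = 0}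
  zero_mem' := ⟨0, zero_mem _, rfl⟩
  add_mem' := by
    rintro A A' ⟨R, h, h0⟩ ⟨R', h', h0'⟩
    exact ⟨R + R', add_mem h h', by rw [Pi.add_apply, h0, h0', add_zero]⟩
  smul_mem' := by
    rintro c A ⟨R, h, h0⟩
    exact ⟨c • R, Submodule.smul_mem _ c h, by rw [Pi.smul_apply, h0, smul_zero]⟩

theorem lsum_terms_mem_normalPairs {k : ℕ} {q : Idx N n →₀ Loc N}
    (hq : ∀ κ ∈ q.support, k ≤ κ.deg) :
    (polSum q, chiSum q) ∈ normalPairs N n k := by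
  have h := Submodule.sum_mem (normalPairs N n k) (t := q.support)
    (f := fun κ => (polTerm κ (q κ), chiTerm κ (q κ))) fun κ hκ => by
      rw [polTerm_apply, chiTerm_apply]
      exact smul_leftPow_mem_normalPairs (mono_base_mem_kerFilt (hq κ hκ)) _ _
  convert h using 1
  refine Prod.ext ?_ ?_
  · rw [Prod.fst_sum]; rfl
  · rw [Prod.snd_sum]; rfl

/-- The characteristic computed from polarized coefficients is the constant coefficient of a normal
form. -/
theorem IsCharacteristic.mem_chiKer {A : MultiOp N n} (h : IsCharacteristic A 0) :
    A ∈ chiKer N n := by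
  obtain ⟨p, ⟨hp, hA⟩, hχ⟩ := h
  obtain ⟨q, hq, hpq⟩ := hp.exists_seq
  have hpair := fun d => lsum_terms_mem_normalPairs (hq d)
  obtain ⟨R, hR, hR0⟩ := exists_normalForms_of_pairs (T := A) hpair fun f => by
    obtain ⟨K, hK⟩ := exists_term_apply_eq_zero f
    have := finsum_coeffs_eq_finsum_seq (c := 0) hq hpq (termAt polTerm f) fun κ hκ a => (hK κ hκ a).1
    simp only [sum_termAt, ← polSum_eq] at this
    rw [← this, hA]
    rfl
  refine ⟨R, hR, ?_⟩
  ext f : 1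
  obtain ⟨K, hK⟩ := exists_term_apply_eq_zero f
  have := finsum_coeffs_eq_finsum_seq (c := 0) hq hpq (termAt chiTerm f) fun κ hκ a => (hK κ hκ a).2
  simp only [sum_termAt, ← chiSum_eq] at this
  rw [hR0, ← this, hχ]
  refine finsum_congr fun κ => ?_
  rw [polMonomial_base]
  rfl

/-- Sums of total derivatives of local differential operators have characteristic zero. -/
theorem isCharacteristic_sum_leftD {B : Fin N → MultiOp N n} (hB : ∀ i, B i ∈ ldo N n) :
    IsCharacteristic (∑ i, leftD i (B i)) 0 := by
  choose C hC hBC using fun i => IsLDO.exists_seq (hB i)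
  have hpair : ∀ d, (∑ i, leftD i (C i d), 0) ∈ polPairs N n d := fun d => by
    have h := Submodule.sum_mem (polPairs N n d) (t := Finset.univ)
      (f := fun i => (leftD i (C i d), 0)) fun i _ =>
        (exists_mem_polPairs (hC i d)).elim fun _ h => leftD_mem_polPairs i h
    convert h using 1
    refine Prod.ext ?_ ?_
    · rw [Prod.fst_sum]
    · rw [Prod.snd_sum]; simp
  choose q hq hqA hqX using hpair
  have hq' : ∀ d, ∀ κ ∈ (q d).support, d ≤ κ.deg + 0 := fun d κ hκ => by
    by_contra h
    exact Finsupp.mem_support_iff.1 hκ (hq d κ (by omega))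
  refine ⟨_, ⟨finiteCoeffs_of_seq (c := 0) (q := q) fun κ => rfl, fun f => ?_⟩, fun f => ?_⟩
  · obtain ⟨K, hK⟩ := exists_term_apply_eq_zero f
    have := finsum_coeffs_eq_finsum_seq hq' (fun κ => rfl) (termAt polTerm f)
      fun κ hκ a => (hK κ hκ a).1
    simp only [sum_termAt, ← polSum_eq, hqA] at this
    refine Eq.trans ?_ this.symm
    simp only [sum_apply, leftD_apply, hBC]
    have hfin : ∀ i, (Function.support fun d => C i d f).Finite := fun i =>
      finite_support_of_mem_opFilt (c := 0) (hC i) f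
    rw [finsum_sum_comm]
    · exact Finset.sum_congr rfl fun i _ => map_finsum (totalD i) (hfin i)
    · refine fun i _ => (hfin i).subset fun d hd => ?_
      rw [Function.mem_support] at hd ⊢
      exact fun h => hd (by rw [h, map_zero])
  · obtain ⟨K, hK⟩ := exists_term_apply_eq_zero f
    have := finsum_coeffs_eq_finsum_seq hq' (fun κ => rfl) (termAt chiTerm f)
      fun κ hκ a => (hK κ hκ a).2
    simp only [sum_termAt, ← chiSum_eq, hqX] at this
    refine Eq.trans ?_ (Eq.trans this.symm ?_)
    · simp
    · refine finsum_congr fun κ => ?_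
      rw [polMonomial_base]
      rfl

end

section

/-! ### Signs and the Koszul homotopy -/

section Koszul

variable {N : ℕ}

/-- The sign `(-1)^{#{l ∈ T : l < i}}` of moving `dx^i` into its place in `dx^T`. -/
def wedgeSign (T : Finset (Fin N)) (i : Fin N) : ℝ := ∏ l ∈ T, if l < i then -1 else 1

theorem wedgeSign_eq_pow (T : Finset (Fin N)) (i : Fin N) :
    wedgeSign T i = (-1) ^ (T.filter (· < i)).card := by
  simp [wedgeSign, Finset.prod_ite]

theorem wedgeSign_mul_self (T : Finset (Fin N)) (i : Fin N) :
    wedgeSign T i * wedgeSign T i = 1 := by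
  rw [wedgeSign, ← Finset.prod_mul_distrib]
  exact Finset.prod_eq_one fun l _ => by split_ifs <;> norm_num

theorem wedgeSign_insert {T : Finset (Fin N)} {j : Fin N} (hj : j ∉ T) (i : Fin N) :
    wedgeSign (insert j T) i = (if j < i then -1 else 1) * wedgeSign T i :=
  Finset.prod_insert hj

theorem wedgeSign_erase {T : Finset (Fin N)} {j : Fin N} (hj : j ∈ T) (i : Fin N) :
    wedgeSign T i = (if j < i then -1 else 1) * wedgeSign (T.erase j) i :=
  (Finset.mul_prod_erase T _ hj).symm

theorem wedgeSign_insert_self {T : Finset (Fin N)} {j : Fin N} (hj : j ∉ T) :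
    wedgeSign (insert j T) j = wedgeSign T j := by
  rw [wedgeSign_insert hj, if_neg (lt_irrefl j), one_mul]

theorem wedgeSign_erase_mul {T : Finset (Fin N)} {i j : Fin N} (hi : i ∈ T) (hj : j ∈ T)
    (hij : i ≠ j) :
    wedgeSign T i * wedgeSign (T.erase i) j = -(wedgeSign T j * wedgeSign (T.erase j) i) := by
  rw [wedgeSign_erase hj i, wedgeSign_erase hi j]
  rcases lt_or_gt_of_ne hij with h | h
  · rw [if_pos h, if_neg h.le.not_gt]; ring
  · rw [if_pos h, if_neg h.le.not_gt]; ring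

theorem wedgeSign_exchange {T : Finset (Fin N)} {i j : Fin N} (hi : i ∈ T) (hj : j ∉ T) :
    wedgeSign T i * wedgeSign (insert j (T.erase i)) j =
      -(wedgeSign (insert j T) j * wedgeSign (insert j T) i) := by
  have hij : i ≠ j := fun h => hj (h ▸ hi)
  rw [wedgeSign_insert_self fun h => hj (Finset.mem_of_mem_erase h), wedgeSign_insert_self hj,
    wedgeSign_insert hj, wedgeSign_erase hi j]
  rcases lt_or_gt_of_ne hij with h | h
  · rw [if_pos h, if_neg h.le.not_gt]; ring
  · rw [if_pos h, if_neg h.le.not_gt]; ring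

/-- The coefficient of the Koszul homotopy from `dx^{T ∪ i}` to `dx^T`. The Laplacian acts on
`(d/dx)^I dx^T` as multiplication by `|I| + N - |T|`. -/
def koszulCoeff (T : Finset (Fin N)) (I : MIdx N) (i : Fin N) : ℝ :=
  wedgeSign (insert i T) i * (I i + 1 : ℕ) * ((order I + Tᶜ.card : ℕ) : ℝ)⁻¹

/-- Exactness of the Koszul complex of the shift operators on families indexed by multi-indices,
away from the constant coefficient in the top degree. -/
theorem koszul_exact {V : Type*} [AddCommGroup V] [Module ℝ V]
    {R : Finset (Fin N) → MIdx N → V}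
    (hR : ∀ T (I : MIdx N), ∑ i ∈ T, wedgeSign T i •
      (if I i = 0 then 0 else R (T.erase i) (I - Pi.single i 1)) = 0)
    (h0 : R Finset.univ 0 = 0) (T : Finset (Fin N)) (I : MIdx N) :
    ∑ i ∈ T, wedgeSign T i • (if I i = 0 then 0 else ∑ j ∈ (T.erase i)ᶜ,
      koszulCoeff (T.erase i) (I - Pi.single i 1) j •
        R (insert j (T.erase i)) (raise j (I - Pi.single i 1))) = R T I := by
  by_cases hw : order I + Tᶜ.card = 0
  · have hI : I = 0 := funext fun i =>
      (Finset.sum_eq_zero_iff.1 (Nat.add_eq_zero_iff.1 hw).1) i (Finset.mem_univ i)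
    have hT : T = Finset.univ := by
      have := (Nat.add_eq_zero_iff.1 hw).2
      rwa [Finset.card_eq_zero, Finset.compl_eq_empty_iff] at this
    subst hI hT
    rw [h0]
    exact Finset.sum_eq_zero fun i _ => by simp
  have hw' : ((order I + Tᶜ.card : ℕ) : ℝ) ≠ 0 := Nat.cast_ne_zero.2 hw
  apply smul_right_injective V hw'
  -- each term of the composite splits into the part `j = i` and the part `j ∉ T`
  have h1 : ∀ i ∈ T, ((order I + Tᶜ.card : ℕ) : ℝ) • (wedgeSign T i •
      (if I i = 0 then 0 else ∑ j ∈ (T.erase i)ᶜ,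
        koszulCoeff (T.erase i) (I - Pi.single i 1) j •
          R (insert j (T.erase i)) (raise j (I - Pi.single i 1)))) =
      (I i : ℝ) • R T I - ∑ j ∈ Tᶜ, (wedgeSign (insert j T) j * (I j + 1 : ℕ)) •
        (wedgeSign (insert j T) i • (if raise j I i = 0 then 0 else
          R ((insert j T).erase i) (raise j I - Pi.single i 1))) := by
    intro i hi
    have hne : ∀ j ∈ Tᶜ, i ≠ j := fun j hj h => Finset.mem_compl.1 hj (h ▸ hi)
    by_cases hIi : I i = 0
    · rw [if_pos hIi, hIi, smul_zero, smul_zero, Nat.cast_zero, zero_smul, zero_sub]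
      refine (neg_eq_zero.2 (Finset.sum_eq_zero fun j hj => ?_)).symm
      have : raise j I i = 0 := by simp [raise, hIi, hne j hj]
      rw [if_pos this, smul_zero, smul_zero]
    · obtain ⟨K, rfl⟩ := exists_raise hIi
      have hK : raise i K - Pi.single i 1 = K := by unfold raise; exact add_tsub_cancel_right _ _
      have hc : (T.erase i)ᶜ = insert i Tᶜ := Finset.compl_erase
      have hcard : (order (raise i K) + Tᶜ.card : ℕ) = order K + (insert i Tᶜ).card := by
        rw [Finset.card_insert_of_notMem (by simpa using hi), order_raise]
        omega
      rw [hcard] at hw' ⊢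
      rw [if_neg hIi, hK, hc, Finset.sum_insert (by simpa using hi), Finset.insert_erase hi,
        smul_add, smul_add, sub_eq_add_neg, ← Finset.sum_neg_distrib]
      congr 1
      · rw [smul_smul, smul_smul, koszulCoeff, Finset.insert_erase hi]
        congr 1
        have : (raise i K i : ℝ) = (K i + 1 : ℕ) := by simp [raise]
        rw [this, hc]
        field_simp
        linear_combination wedgeSign_mul_self T i
      · rw [Finset.smul_sum, Finset.smul_sum]
        refine Finset.sum_congr rfl fun j hj => ?_
        have hij := hne j hj
        have hj' := Finset.mem_compl.1 hj
        have e1 : raise j (raise i K) i ≠ 0 := by simp [raise]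
        have e2 : raise j (raise i K) - Pi.single i 1 = raise j K := by
          rw [raise_comm j i]; unfold raise; exact add_tsub_cancel_right _ _
        have e3 : (insert j T).erase i = insert j (T.erase i) :=
          Finset.erase_insert_of_ne hij.symm
        have e4 : raise i K j = K j := by simp [raise, hij.symm]
        rw [if_neg e1, e2, e3, e4, smul_smul, smul_smul, smul_smul, ← neg_smul, koszulCoeff, hc]
        congr 1
        field_simp
        linear_combination wedgeSign_exchange hi hj'
  have h2 : ∀ j ∈ Tᶜ, ∑ i ∈ T, (wedgeSign (insert j T) j * (I j + 1 : ℕ)) •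
        (wedgeSign (insert j T) i • (if raise j I i = 0 then 0 else
          R ((insert j T).erase i) (raise j I - Pi.single i 1))) =
      -(((I j + 1 : ℕ) : ℝ) • R T I) := by
    intro j hj
    have hj' := Finset.mem_compl.1 hj
    have h := hR (insert j T) (raise j I)
    have e1 : raise j I j ≠ 0 := by simp [raise]
    have e2 : raise j I - Pi.single j 1 = I := by unfold raise; exact add_tsub_cancel_right _ _
    rw [Finset.sum_insert hj', if_neg e1, e2, Finset.erase_insert hj'] at h
    rw [← Finset.smul_sum, eq_neg_of_add_eq_zero_right h, smul_neg, smul_smul]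
    congr 2
    linear_combination ((I j + 1 : ℕ) : ℝ) * wedgeSign_mul_self (insert j T) j
  change ((order I + Tᶜ.card : ℕ) : ℝ) • _ = ((order I + Tᶜ.card : ℕ) : ℝ) • R T I
  rw [Finset.smul_sum, Finset.sum_congr rfl h1, Finset.sum_sub_distrib, Finset.sum_comm,
    Finset.sum_congr rfl h2, Finset.sum_neg_distrib, sub_neg_eq_add, ← Finset.sum_smul,
    ← Finset.sum_smul, ← add_smul]
  congr 1
  rw [order, ← Finset.sum_add_sum_compl T]
  push_cast
  rw [Finset.sum_add_distrib]
  simp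
  ring

theorem sum_antisymm_eq_zero {ι V : Type*} [AddCommGroup V] [Module ℝ V] (s : Finset ι)
    (a : ι → ι → V) (ha : ∀ i ∈ s, ∀ j ∈ s, a i j = -a j i) : ∑ i ∈ s, ∑ j ∈ s, a i j = 0 := by
  have : ∑ i ∈ s, ∑ j ∈ s, a i j = -∑ i ∈ s, ∑ j ∈ s, a i j := by
    conv_rhs => rw [Finset.sum_comm]
    rw [← Finset.sum_neg_distrib]
    refine Finset.sum_congr rfl fun i hi => ?_
    rw [← Finset.sum_neg_distrib]
    exact Finset.sum_congr rfl fun j hj => ha i hi j hj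
  have h2 : (2 : ℝ) • ∑ i ∈ s, ∑ j ∈ s, a i j = 0 := by
    rw [two_smul]
    nth_rewrite 1 [this]
    exact neg_add_cancel _
  exact (smul_eq_zero.1 h2).resolve_left two_ne_zero

end Koszul

/-! ### The horizontal differential -/

section Horizontal

variable {N n : ℕ}

theorem dH_apply (w : Hor N) (T : Finset (Fin N)) :
    dH w T = ∑ i ∈ T, wedgeSign T i • totalD i (w (T.erase i)) := by
  refine Finset.sum_congr rfl fun i _ => ?_
  rw [wedgeSign_eq_pow, Algebra.smul_def, map_pow, map_neg, map_one]

theorem dH_dH (w : Hor N) : dH (dH w) = 0 := by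
  funext T
  have key := sum_antisymm_eq_zero T (fun i j => if i = j then (0 : Loc N) else
    (wedgeSign T i * wedgeSign (T.erase i) j) •
      totalD i (totalD j (w ((T.erase i).erase j)))) fun i hi j hj => by
    by_cases h : i = j
    · simp [h]
    · rw [if_neg h, if_neg (Ne.symm h), wedgeSign_erase_mul hi hj h, neg_smul,
        Finset.erase_right_comm]
      congr 2
      exact LinearMap.congr_fun (totalD_commute i j).eq _
  rw [dH_apply]
  refine Eq.trans (Finset.sum_congr rfl fun i hi => ?_) key
  rw [dH_apply, map_sum, Finset.smul_sum, ← Finset.add_sum_erase _ _ hi, if_pos rfl, zero_add]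
  refine Finset.sum_congr rfl fun j hj => ?_
  rw [if_neg (Finset.ne_of_mem_erase hj).symm, map_smul, smul_smul]

theorem degSign_apply (w : Hor N) (T : Finset (Fin N)) :
    degSign w T = ((-1 : ℝ) ^ (N - T.card)) • w T := by
  rw [Algebra.smul_def, map_pow, map_neg, map_one]
  rfl

theorem dH_degSign (w : Hor N) : dH (degSign w) = (-1 : ℝ) • degSign (dH w) := by
  funext T
  rw [Pi.smul_apply, degSign_apply, dH_apply, dH_apply, smul_smul, Finset.smul_sum]
  refine Finset.sum_congr rfl fun i hi => ?_
  have h1 : T.card ≤ N := by simpa using Finset.card_le_univ T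
  have h2 : 0 < T.card := Finset.card_pos.2 ⟨i, hi⟩
  have h3 : N - (T.erase i).card = N - T.card + 1 := by
    rw [Finset.card_erase_of_mem hi]; omega
  rw [degSign_apply, map_smul, h3, smul_comm, pow_succ']

theorem dH_single (S : Finset (Fin N)) (a : Loc N) :
    dH (Pi.single S a : Hor N) =
      ∑ i ∈ Sᶜ, wedgeSign (insert i S) i • (Pi.single (insert i S) (totalD i a) : Hor N) := by
  funext T
  have h1 : dH (Pi.single S a : Hor N) T =
      ∑ i, if i ∈ T ∧ T.erase i = S then wedgeSign T i • totalD i a else 0 := by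
    rw [dH_apply]
    refine (Finset.sum_congr rfl fun i hi => ?_).trans
      (Finset.sum_subset (Finset.subset_univ T) fun i _ hi => if_neg fun h => hi h.1)
    by_cases h : T.erase i = S
    · rw [if_pos ⟨hi, h⟩, h, Pi.single_eq_same]
    · rw [if_neg fun h' => h h'.2, Pi.single_eq_of_ne h, map_zero, smul_zero]
  rw [h1, Finset.sum_apply]
  refine ((Finset.sum_congr rfl fun i hi => ?_).trans
    (Finset.sum_subset (Finset.subset_univ Sᶜ) fun i _ hi => if_neg ?_)).symm
  · have hi' := Finset.mem_compl.1 hi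
    rw [Pi.smul_apply]
    by_cases h : T = insert i S
    · subst h
      rw [if_pos ⟨Finset.mem_insert_self _ _, Finset.erase_insert hi'⟩, Pi.single_eq_same]
    · rw [if_neg fun h' => h (by rw [← h'.2, Finset.insert_erase h'.1]), Pi.single_eq_of_ne h,
        smul_zero]
  · rintro ⟨-, rfl⟩
    exact hi (Finset.mem_compl.2 (Finset.notMem_erase i T))

/-! ### Matrix coefficients -/

theorem matrixCoeff_apply (f : HorOp N n) (S : Fin n → Finset (Fin N)) (T : Finset (Fin N))
    (g : Fin n → Loc N) : matrixCoeff f S T g = f (fun j => Pi.single (S j) (g j)) T := rfl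

/-- `f ↦ matrixCoeff f S T` as a linear map. -/
def matrixCoeffLin (S : Fin n → Finset (Fin N)) (T : Finset (Fin N)) :
    HorOp N n →ₗ[ℝ] MultiOp N n where
  toFun f := matrixCoeff f S T
  map_add' _ _ := rfl
  map_smul' _ _ := rfl

/-- `f ↦ f ∘ d_H^{⊗ n}` as a linear map. -/
def tensorD : HorOp N n →ₗ[ℝ] HorOp N n where
  toFun := compTensorD
  map_add' f g := by
    refine MultilinearMap.ext fun w => ?_
    simp [compTensorD, sum_apply, Finset.sum_add_distrib]
  map_smul' c f := by
    refine MultilinearMap.ext fun w => ?_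
    simp [compTensorD, sum_apply, Finset.smul_sum]

/-- `f ↦ d_H ∘ f` as a linear map. -/
def leftDH : HorOp N n →ₗ[ℝ] HorOp N n where
  toFun f := dH.compMultilinearMap f
  map_add' f g := by
    refine MultilinearMap.ext fun w => ?_
    exact map_add dH _ _
  map_smul' c f := by
    refine MultilinearMap.ext fun w => ?_
    exact map_smul dH _ _

/-- The linear map applied to the `l`-th argument in the `j`-th term of `d_H^{⊗ n}`. -/
def slotMap (j l : Fin n) : Module.End ℝ (Hor N) :=
  if l < j then degSign else if l = j then dH else LinearMap.id

theorem tensorD_apply (f : HorOp N n) (w : Fin n → Hor N) :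
    tensorD f w = ∑ j, f fun l => slotMap j l (w l) := by
  change compTensorD f w = _
  rw [compTensorD, sum_apply]
  rfl

theorem leftDH_apply (f : HorOp N n) (w : Fin n → Hor N) : leftDH f w = dH (f w) := rfl

theorem leftDH_tensorD (f : HorOp N n) : leftDH (tensorD f) = tensorD (leftDH f) := by
  refine MultilinearMap.ext fun w => ?_
  simp only [leftDH_apply, tensorD_apply, map_sum]

/-- `d_H^{⊗ n}` squares to zero: exchanging the slots `l < j` in which `d_H` acts changes the sign,
since the degree sign in the `l`-th slot anticommutes with `d_H`. -/
theorem tensorD_tensorD (f : HorOp N n) : tensorD (tensorD f) = 0 := by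
  refine MultilinearMap.ext fun w => ?_
  have hlt : ∀ j l : Fin n, l < j →
      f (fun m => slotMap l m (slotMap j m (w m))) =
        -f (fun m => slotMap j m (slotMap l m (w m))) := by
    intro j l h
    have e : (fun m => slotMap l m (slotMap j m (w m))) =
        Function.update (fun m => slotMap j m (slotMap l m (w m))) l
          ((-1 : ℝ) • slotMap j l (slotMap l l (w l))) := by
      funext m
      by_cases hm : m = l
      · subst hm
        rw [Function.update_self]
        simp only [slotMap, if_pos h, lt_irrefl, if_false, if_true]
        exact dH_degSign _
      · rw [Function.update_of_ne hm]
        rcases lt_or_gt_of_ne hm with h' | h'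
        · simp [slotMap, h', h'.trans h]
        · simp [slotMap, hm, h'.le.not_gt]
    rw [e, MultilinearMap.map_update_smul, Function.update_eq_self, neg_one_smul]
  have hself : ∀ j : Fin n, f (fun m => slotMap j m (slotMap j m (w m))) = 0 := fun j =>
    f.map_coord_zero j (by simp [slotMap, dH_dH])
  simp only [tensorD_apply, zero_apply]
  refine sum_antisymm_eq_zero Finset.univ _ fun j _ l _ => ?_
  rcases lt_trichotomy j l with h | h | h
  · rw [hlt l j h, neg_neg]
  · subst h
    rw [hself, neg_zero]
  · exact hlt j l h

theorem horOp_apply (f : HorOp N n) (w : Fin n → Hor N) (T : Finset (Fin N)) :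
    f w T = ∑ S : Fin n → Finset (Fin N), matrixCoeff f S T fun j => w j (S j) := by
  have hw : w = fun j => ∑ S, Pi.single S (w j S) :=
    funext fun j => (Finset.univ_sum_single (w j)).symm
  conv_lhs => rw [hw, MultilinearMap.map_sum, Finset.sum_apply]
  rfl

theorem horOp_ext {f g : HorOp N n} (h : ∀ S T, matrixCoeff f S T = matrixCoeff g S T) :
    f = g := by
  refine MultilinearMap.ext fun w => ?_
  funext T
  rw [horOp_apply, horOp_apply]
  simp only [h]

theorem exists_horOp (M : (Fin n → Finset (Fin N)) → Finset (Fin N) → MultiOp N n) :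
    ∃ f : HorOp N n, ∀ S T, matrixCoeff f S T = M S T := by
  refine ⟨MultilinearMap.pi fun T => ∑ S, (M S T).compLinearMap fun j => LinearMap.proj (S j),
    fun S T => ?_⟩
  ext g : 1
  rw [matrixCoeff_apply, MultilinearMap.pi_apply, sum_apply, Finset.sum_eq_single S]
  · rw [MultilinearMap.compLinearMap_apply]
    congr 1
    funext j
    simp
  · intro S' _ hS'
    obtain ⟨j, hj⟩ := Function.ne_iff.1 hS'
    rw [MultilinearMap.compLinearMap_apply]
    exact (M S' T).map_coord_zero j (by simp [hj])
  · simp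

theorem matrixCoeff_leftDH (f : HorOp N n) (S : Fin n → Finset (Fin N)) (T : Finset (Fin N)) :
    matrixCoeff (leftDH f) S T =
      ∑ i ∈ T, wedgeSign T i • leftD i (matrixCoeff f S (T.erase i)) := by
  ext g : 1
  rw [matrixCoeff_apply, leftDH_apply, dH_apply, sum_apply]
  rfl

/-- The Koszul sign of moving `d_H` past the arguments before the `j`-th one. -/
def tensorSign (S : Fin n → Finset (Fin N)) (j : Fin n) : ℝ :=
  ∏ l, if l < j then (-1) ^ (N - (S l).card) else 1

theorem tensorSign_ne_zero (S : Fin n → Finset (Fin N)) (j : Fin n) : tensorSign S j ≠ 0 :=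
  Finset.prod_ne_zero_iff.2 fun l _ => by split_ifs <;> simp

theorem matrixCoeff_tensorD (f : HorOp N n) (S : Fin n → Finset (Fin N)) (T : Finset (Fin N)) :
    matrixCoeff (tensorD f) S T = ∑ j, ∑ i ∈ (S j)ᶜ,
      (tensorSign S j * wedgeSign (insert i (S j)) i) •
        compD i j (matrixCoeff f (Function.update S j (insert i (S j))) T) := by
  ext g : 1
  rw [matrixCoeff_apply, tensorD_apply, Finset.sum_apply, sum_apply]
  refine Finset.sum_congr rfl fun j _ => ?_
  have e : (fun l => slotMap j l (Pi.single (S l) (g l) : Hor N)) = fun l =>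
      (if l < j then (-1 : ℝ) ^ (N - (S l).card) else 1) •
        Function.update (fun l => (Pi.single (S l) (g l) : Hor N)) j
          (dH (Pi.single (S j) (g j))) l := by
    funext l
    rcases lt_trichotomy l j with h | h | h
    · rw [if_pos h, Function.update_of_ne h.ne, slotMap, if_pos h]
      funext T
      rw [degSign_apply, Pi.smul_apply]
      by_cases hT : T = S l
      · rw [hT]
      · rw [Pi.single_eq_of_ne hT, smul_zero, smul_zero]
    · subst h
      simp [slotMap]
    · simp [slotMap, h.ne', h.le.not_gt]
  rw [e, MultilinearMap.map_smul_univ, dH_single, MultilinearMap.map_update_sum, Finset.smul_sum,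
    Finset.sum_apply, sum_apply]
  refine Finset.sum_congr rfl fun i _ => ?_
  rw [MultilinearMap.map_update_smul, smul_smul, Pi.smul_apply, smul_apply, compD_apply,
    matrixCoeff_apply]
  congr 1
  refine congrArg (fun v => f v T) (funext fun l => ?_)
  by_cases h : l = j
  · subst h; simp
  · simp [h]

end Horizontal

end

section

/-! ### Primitives of closed operators -/

variable {N n : ℕ}

theorem wedgeSign_ne_zero (T : Finset (Fin N)) (i : Fin N) : wedgeSign T i ≠ 0 :=
  left_ne_zero_of_mul_eq_one (wedgeSign_mul_self T i)

theorem eq_of_normalForms [NeZero n] {R : MIdx N → MultiOp N n} {A B : MultiOp N n}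
    (hA : (R, A) ∈ normalForms N n) (hB : (R, B) ∈ normalForms N n) : A = B :=
  MultilinearMap.ext fun f => (hA.2 f).trans (hB.2 f).symm

/-- The Koszul homotopy preserves normal families. -/
theorem exists_koszul_normalForms [NeZero n] {R : Finset (Fin N) → MIdx N → MultiOp N n}
    (hR : ∀ T, IsNormal (R T)) (T : Finset (Fin N)) :
    ∃ B, (fun I => ∑ j ∈ Tᶜ, koszulCoeff T I j • R (insert j T) (raise j I), B) ∈
      normalForms N n := by
  have h : (fun I => ∑ j ∈ Tᶜ, koszulCoeff T I j • R (insert j T) (raise j I)) =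
      ∑ j ∈ Tᶜ, fun I => koszulCoeff T I j • R (insert j T) (raise j I) := by
    funext I
    rw [Finset.sum_apply]
  rw [h]
  refine IsNormal.exists_normalForms (Finset.sum_induction _ IsNormal (fun _ _ => IsNormal.add)
    (normalForms N n).zero_mem.1 fun j _ => ?_)
  exact (hR (insert j T)).reindex _ _ (raise_injective j).injOn

/-- The sequence of operators with values in horizontal forms is exact in positive degrees, and in
degree zero a local differential operator is a total divergence if its normal form has vanishing
constant coefficient. -/
theorem exists_primitive [NeZero n] {C : HorOp N n} (hldo : ∀ S T, matrixCoeff C S T ∈ ldo N n)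
    (hd : leftDH C = 0) (hχ : ∀ S, matrixCoeff C S Finset.univ ∈ chiKer N n) :
    ∃ B : HorOp N n, (∀ S T, matrixCoeff B S T ∈ ldo N n) ∧ leftDH B = C ∧
      ∀ S T, matrixCoeff B S T ≠ 0 → ∃ i ∉ T, matrixCoeff C S (insert i T) ≠ 0 := by
  have hex : ∀ S T, ∃ R, (R, matrixCoeff C S T) ∈ normalForms N n ∧
      (T = Finset.univ → R 0 = 0) := by
    intro S T
    by_cases hT : T = Finset.univ
    · subst hT
      obtain ⟨R, hR, h0⟩ := hχ S
      exact ⟨R, hR, fun _ => h0⟩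
    · obtain ⟨R, hR⟩ := exists_normalForms (hldo S T)
      exact ⟨R, hR, fun h => absurd h hT⟩
  choose R hR hR0 using hex
  choose M hM using fun S T => exists_koszul_normalForms (fun T => (hR S T).1) T
  have hclosed : ∀ S T, ∑ i ∈ T, wedgeSign T i • shift i (R S (T.erase i)) = 0 := by
    intro S T
    refine eq_zero_of_normalForms ?_
    have h := Submodule.sum_mem (normalForms N n) (t := T) fun i _ =>
      Submodule.smul_mem _ (wedgeSign T i) (shift_mem_normalForms i (hR S (T.erase i)))
    have h0 : ∑ i ∈ T, wedgeSign T i • leftD i (matrixCoeff C S (T.erase i)) = 0 := by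
      rw [← matrixCoeff_leftDH, hd]; rfl
    convert h using 1
    refine Prod.ext ?_ ?_
    · rw [Prod.fst_sum]; rfl
    · rw [Prod.snd_sum, ← h0]; rfl
  obtain ⟨B, hB⟩ := exists_horOp M
  refine ⟨B, fun S T => ?_, horOp_ext fun S T => ?_, fun S T hne => ?_⟩
  · rw [hB]
    exact mem_ldo_of_normalForms (hM S T)
  · have h := Submodule.sum_mem (normalForms N n) (t := T) fun i _ =>
      Submodule.smul_mem _ (wedgeSign T i) (shift_mem_normalForms i (hM S (T.erase i)))
    refine eq_of_normalForms (R := R S T) ?_ (hR S T)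
    rw [matrixCoeff_leftDH]
    convert h using 1
    refine Prod.ext ?_ ?_
    · rw [Prod.fst_sum]
      funext I
      refine MultilinearMap.ext fun f => ?_
      have hk := koszul_exact (R := fun T I => R S T I f) (fun T I => ?_)
        (by rw [hR0 S _ rfl]; rfl) T I
      · refine hk.symm.trans ?_
        rw [Finset.sum_apply, sum_apply]
        refine Finset.sum_congr rfl fun i _ => ?_
        change _ = wedgeSign T i • ((if I i = 0 then 0 else 1 : ℝ) •
          (∑ j ∈ (T.erase i)ᶜ, _ : MultiOp N n) f)
        rw [sum_apply]
        split_ifs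
        · rw [zero_smul]
        · rw [one_smul]; rfl
      · have h := congrArg (fun Q => Q I f) (hclosed S T)
        refine Eq.trans ?_ h
        rw [Finset.sum_apply, sum_apply]
        refine Finset.sum_congr rfl fun i _ => ?_
        change _ = wedgeSign T i • ((if I i = 0 then 0 else 1 : ℝ) •
          R S (T.erase i) (I - Pi.single i 1) f)
        split_ifs
        · rw [zero_smul]
        · rw [one_smul]
    · rw [Prod.snd_sum]
      exact Finset.sum_congr rfl fun i _ => by rw [hB]; rfl
  · by_contra! h
    refine hne ?_
    rw [hB]
    have hz : ∀ j ∈ Tᶜ, R S (insert j T) = 0 := fun j hj => eq_zero_of_normalForms (by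
      have := hR S (insert j T)
      rwa [h j (Finset.mem_compl.1 hj)] at this)
    have hM0 := hM S T
    have : (fun I => ∑ j ∈ Tᶜ, koszulCoeff T I j • R S (insert j T) (raise j I)) = 0 :=
      funext fun I => Finset.sum_eq_zero fun j hj => by rw [hz j hj, Pi.zero_apply, smul_zero]
    rw [this] at hM0
    exact eq_of_normalForms hM0 (zero_mem _)

/-! ### Construction of lifts -/

/-- The matrix coefficients of `f` are local differential operators, and `f` takes
`[(Ω_*)^{⊗ n}]_s` to `Ω_t` and all other degrees to zero. -/
structure IsHomogeneous (f : HorOp N n) (s t : ℕ) : Prop where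
  ldo : ∀ S T, matrixCoeff f S T ∈ ldo N n
  degree : ∀ S T, matrixCoeff f S T ≠ 0 → ∑ j, (N - (S j).card) = s ∧ T.card + t = N

theorem IsHomogeneous.tensorD {f : HorOp N n} {s t : ℕ} (hf : IsHomogeneous f s t) :
    IsHomogeneous (tensorD f) (s + 1) t where
  ldo S T := by
    rw [matrixCoeff_tensorD]
    exact Submodule.sum_mem _ fun j _ => Submodule.sum_mem _ fun i _ =>
      Submodule.smul_mem _ _ (compD_mem_ldo i j (hf.ldo _ _))
  degree S T h := by
    rw [matrixCoeff_tensorD] at h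
    obtain ⟨j, -, h⟩ := Finset.exists_ne_zero_of_sum_ne_zero h
    obtain ⟨i, hi, h⟩ := Finset.exists_ne_zero_of_sum_ne_zero h
    have hne : matrixCoeff f (Function.update S j (insert i (S j))) T ≠ 0 := fun h0 =>
      h (by rw [h0, map_zero, smul_zero])
    obtain ⟨h1, h2⟩ := hf.degree _ _ hne
    refine ⟨?_, h2⟩
    have hi' := Finset.mem_compl.1 hi
    have hlt : (insert i (S j)).card ≤ N := by simpa using Finset.card_le_univ (insert i (S j))
    rw [Finset.card_insert_of_notMem hi'] at hlt
    rw [← Finset.add_sum_erase _ _ (Finset.mem_univ j)] at h1 ⊢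
    rw [Function.update_self, Finset.card_insert_of_notMem hi',
      Finset.sum_congr rfl fun l hl => by
        rw [Function.update_of_ne (Finset.ne_of_mem_erase hl)]] at h1
    omega

theorem IsHomogeneous.degree_of_apply_ne_zero {f : HorOp N n} {s t : ℕ} (hf : IsHomogeneous f s t)
    {w : Fin n → Hor N} {r : Fin n → ℕ} (hw : ∀ j, InDegree (r j) (w j)) {T : Finset (Fin N)}
    (h : f w T ≠ 0) : ∑ j, r j = s ∧ T.card + t = N := by
  rw [horOp_apply] at h
  obtain ⟨S, -, hS⟩ := Finset.exists_ne_zero_of_sum_ne_zero h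
  have hne : matrixCoeff f S T ≠ 0 := fun h0 => hS (by rw [h0]; rfl)
  obtain ⟨h1, h2⟩ := hf.degree S T hne
  refine ⟨?_, h2⟩
  rw [← h1]
  refine Finset.sum_congr rfl fun j _ => ?_
  have := hw j (S j) fun h0 => hS ((matrixCoeff f S T).map_coord_zero j h0)
  omega

theorem IsHomogeneous.zero (s t : ℕ) : IsHomogeneous (0 : HorOp N n) s t :=
  ⟨fun _ _ => zero_mem (HorizontalLDO.ldo N n), fun _ _ h => absurd rfl h⟩

theorem IsHomogeneous.eq_zero {f : HorOp N n} {s t : ℕ} (hf : IsHomogeneous f s t) (h : N < t) :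
    f = 0 :=
  horOp_ext fun S T => by
    by_contra hne
    have := (hf.degree S T hne).2
    omega

theorem leftDH_eq_zero {f : HorOp N n} {s : ℕ} (hf : IsHomogeneous f s 0) : leftDH f = 0 :=
  horOp_ext fun S T => by
    rw [matrixCoeff_leftDH]
    refine Finset.sum_eq_zero fun i hi => ?_
    have : matrixCoeff f S (T.erase i) = 0 := by
      by_contra hne
      have h1 := (hf.degree S _ hne).2
      have h2 : T.card ≤ N := by simpa using Finset.card_le_univ T
      have h3 := Finset.card_erase_lt_of_mem hi
      omega
    rw [this, map_zero, smul_zero]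

/-- A local differential operator on `[(Ω_*)^{⊗ n}]_0`, extended by zero to the other degrees. -/
theorem exists_extension {A : MultiOp N n} (hA : A ∈ ldo N n) : ∃ f : HorOp N n,
    IsHomogeneous f 0 0 ∧ matrixCoeff f (fun _ => Finset.univ) Finset.univ = A ∧
      ∀ S T, matrixCoeff f S T = A ∨ matrixCoeff f S T = 0 := by
  classical
  obtain ⟨f, hf⟩ := exists_horOp fun (S : Fin n → Finset (Fin N)) T =>
    if S = (fun _ => Finset.univ) ∧ T = Finset.univ then A else 0
  refine ⟨f, ⟨fun S T => ?_, fun S T h => ?_⟩, by rw [hf, if_pos ⟨rfl, rfl⟩], fun S T => ?_⟩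
  · rw [hf]
    split_ifs
    exacts [hA, zero_mem _]
  · rw [hf] at h
    have h : S = (fun _ => Finset.univ) ∧ T = Finset.univ := by
      by_contra h'
      exact h (if_neg h')
    rw [h.1, h.2]
    simp
  · rw [hf]
    split_ifs
    exacts [Or.inl rfl, Or.inr rfl]

/-- Homogeneous components satisfying the recursion `d_H f_{s+1} = f_s d_H^{⊗ n}` assemble to a
lift. -/
theorem isLift_sum {A : MultiOp N n} {F : ℕ → HorOp N n} (hF : ∀ s, IsHomogeneous (F s) s s)
    (h0 : matrixCoeff (F 0) (fun _ => Finset.univ) Finset.univ = A)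
    (hd : ∀ s, leftDH (F (s + 1)) = tensorD (F s)) :
    IsLift A (∑ s ∈ Finset.range (N + 1), F s) ∧
      ∀ s, F s = 0 → ComponentZero (∑ s ∈ Finset.range (N + 1), F s) s := by
  have happly : ∀ (w : Fin n → Hor N) (r : Fin n → ℕ), (∀ j, InDegree (r j) (w j)) → ∀ T,
      (∑ s ∈ Finset.range (N + 1), F s) w T ≠ 0 →
        F (∑ j, r j) w T ≠ 0 ∧ T.card + ∑ j, r j = N := by
    intro w r hw T hT
    rw [sum_apply, Finset.sum_apply] at hT
    obtain ⟨s, -, hs⟩ := Finset.exists_ne_zero_of_sum_ne_zero hT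
    obtain ⟨h1, h2⟩ := (hF s).degree_of_apply_ne_zero hw hs
    rw [h1]
    exact ⟨hs, h2⟩
  have hcoeff : ∀ S T, matrixCoeff (∑ s ∈ Finset.range (N + 1), F s) S T =
      ∑ s ∈ Finset.range (N + 1), matrixCoeff (F s) S T := fun S T =>
    map_sum (matrixCoeffLin S T) _ _
  refine ⟨⟨⟨fun w r hw T hT => (happly w r hw T hT).2, fun S T => ?_⟩, ?_, ?_⟩,
    fun s hs w r hw hr => ?_⟩
  · rw [hcoeff]
    exact Submodule.sum_mem (ldo N n) fun s _ => (hF s).ldo S T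
  · change leftDH _ = tensorD _
    -- the sums telescope by the recursion; `F (N + 1)` vanishes for degree reasons
    rw [map_sum, map_sum, Finset.sum_range_succ', leftDH_eq_zero (hF 0), add_zero,
      Finset.sum_range_succ, ← hd N, (hF (N + 1)).eq_zero (Nat.lt_succ_self N), map_zero, add_zero]
    exact Finset.sum_congr rfl fun s _ => hd s
  · rw [hcoeff, Finset.sum_range_succ', h0]
    refine (congrArg (· + A) (Finset.sum_eq_zero fun s _ => ?_)).trans (zero_add A)
    by_contra hne
    have := ((hF (s + 1)).degree _ _ hne).1
    simp at this
  · funext T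
    by_contra hT
    refine (happly w r hw T hT).1 ?_
    rw [hr, hs]; rfl

variable [NeZero n]

/-- If all operators `A d/dx^i_j` are total divergences, a lift is built degree by degree. -/
theorem exists_lift {A : MultiOp N n} (hA : A ∈ ldo N n)
    (hχ : ∀ (i : Fin N) (j : Fin n), compD i j A ∈ chiKer N n) : ∃ f : HorOp N n, IsLift A f := by
  obtain ⟨f₀, hf₀, htop, hcases⟩ := exists_extension hA
  let P : ℕ → HorOp N n → Prop := fun s f => IsHomogeneous f s s ∧ leftDH (tensorD f) = 0 ∧
    ∀ S, matrixCoeff (tensorD f) S Finset.univ ∈ chiKer N n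
  have hP0 : P 0 f₀ := by
    refine ⟨hf₀, by rw [leftDH_tensorD, leftDH_eq_zero hf₀, map_zero], fun S => ?_⟩
    rw [matrixCoeff_tensorD]
    refine Submodule.sum_mem _ fun j _ => Submodule.sum_mem _ fun i _ => Submodule.smul_mem _ _ ?_
    rcases hcases (Function.update S j (insert i (S j))) Finset.univ with h | h
    · rw [h]; exact hχ i j
    · rw [h, map_zero]; exact zero_mem _
  have hstep : ∀ s f, P s f → ∃ g, P (s + 1) g ∧ leftDH g = tensorD f := by
    rintro s f ⟨h1, h2, h3⟩
    obtain ⟨g, hg, hgd, hgs⟩ := exists_primitive h1.tensorD.ldo h2 h3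
    have hhom : IsHomogeneous g (s + 1) (s + 1) := ⟨hg, fun S T hne => by
      obtain ⟨i, hi, h⟩ := hgs S T hne
      obtain ⟨e1, e2⟩ := h1.tensorD.degree _ _ h
      rw [Finset.card_insert_of_notMem hi] at e2
      exact ⟨e1, by omega⟩⟩
    refine ⟨g, ⟨hhom, by rw [leftDH_tensorD, hgd, tensorD_tensorD], fun S => ?_⟩, hgd⟩
    have : matrixCoeff (tensorD g) S Finset.univ = 0 := by
      by_contra hne
      have := (hhom.tensorD.degree S _ hne).2
      rw [Finset.card_univ, Fintype.card_fin] at this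
      omega
    rw [this]
    exact zero_mem _
  choose! step hst using hstep
  let F : ℕ → HorOp N n := fun s => Nat.rec f₀ step s
  have hF : ∀ s, P s (F s) := fun s => by
    induction s with
    | zero => exact hP0
    | succ s ih => exact (hst s _ ih).1
  exact ⟨_, (isLift_sum (fun s => (hF s).1) htop fun s => (hst s _ (hF s)).2).1⟩

/-- If `A` is itself a total divergence `d_H h`, it has the lift with `f_1 = h d_H^{⊗ n}` and no
components in higher degrees. -/
theorem exists_short_lift {A : MultiOp N n} (hA : A ∈ ldo N n) (hχ : A ∈ chiKer N n) :
    ∃ f : HorOp N n, IsLift A f ∧ ∀ s : ℕ, 2 ≤ s → ComponentZero f s := by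
  obtain ⟨f₀, hf₀, htop, hcases⟩ := exists_extension hA
  obtain ⟨h, hh, hhd, hhs⟩ := exists_primitive hf₀.ldo (leftDH_eq_zero hf₀) fun S => by
    rcases hcases S Finset.univ with h | h
    · rwa [h]
    · rw [h]; exact zero_mem _
  have hhom : IsHomogeneous h 0 1 := ⟨hh, fun S T hne => by
    obtain ⟨i, hi, h⟩ := hhs S T hne
    obtain ⟨e1, e2⟩ := hf₀.degree _ _ h
    rw [Finset.card_insert_of_notMem hi] at e2
    exact ⟨e1, by omega⟩⟩
  let F : ℕ → HorOp N n := fun s => match s with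
    | 0 => f₀
    | 1 => tensorD h
    | _ + 2 => 0
  have hlift := isLift_sum (F := F) (fun s => ?_) htop fun s => ?_
  · refine ⟨_, hlift.1, fun s hs => hlift.2 s ?_⟩
    obtain ⟨s, rfl⟩ := Nat.exists_eq_add_of_le' hs
    rfl
  · match s with
    | 0 => exact hf₀
    | 1 => exact hhom.tensorD
    | s + 2 => exact IsHomogeneous.zero _ _
  · match s with
    | 0 =>
      change leftDH (tensorD h) = tensorD f₀
      rw [leftDH_tensorD, hhd]
    | 1 =>
      change leftDH 0 = tensorD (tensorD h)
      rw [tensorD_tensorD, map_zero]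
    | s + 2 =>
      change leftDH 0 = tensorD 0
      rw [map_zero, map_zero]

/-- The degree one part of a lift exhibits each `A d/dx^i_j` as a total divergence. -/
theorem IsLift.isCharacteristic_compD {A : MultiOp N n} {f : HorOp N n} (hf : IsLift A f)
    (i : Fin N) (j : Fin n) : IsCharacteristic (compD i j A) 0 := by
  set S : Fin n → Finset (Fin N) :=
    Function.update (fun _ => Finset.univ) j (Finset.univ.erase i) with hS
  have hSj : S j = Finset.univ.erase i := Function.update_self _ _ _
  set c : ℝ := tensorSign S j * wedgeSign (insert i (S j)) i with hc
  have hc0 : c ≠ 0 := mul_ne_zero (tensorSign_ne_zero S j) (wedgeSign_ne_zero _ i)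
  have h1 : matrixCoeff (tensorD f) S Finset.univ = c • compD i j A := by
    rw [matrixCoeff_tensorD, Finset.sum_eq_single j, hSj, Finset.compl_erase, Finset.compl_univ,
      insert_empty_eq, Finset.sum_singleton, hc, hSj, Finset.insert_erase (Finset.mem_univ i), hS,
      Function.update_idem, Function.update_eq_self_iff.2 rfl, hf.zero]
    · intro l _ hl
      have : S l = Finset.univ := Function.update_of_ne hl _ _
      rw [this, Finset.compl_univ, Finset.sum_empty]
    · intro h
      exact absurd (Finset.mem_univ j) h
  have h2 : leftDH f = tensorD f := hf.chain
  have h3 : compD i j A = ∑ k, leftD k ((c⁻¹ * wedgeSign Finset.univ k) •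
      matrixCoeff f S (Finset.univ.erase k)) := by
    have : compD i j A = c⁻¹ • matrixCoeff (leftDH f) S Finset.univ := by
      rw [h2, h1, smul_smul, inv_mul_cancel₀ hc0, one_smul]
    rw [this, matrixCoeff_leftDH, Finset.smul_sum]
    exact Finset.sum_congr rfl fun k _ => by rw [map_smul, smul_smul]
  rw [h3]
  exact isCharacteristic_sum_leftD fun k => (ldo N n).smul_mem _ (hf.dEnd.ldo S _)

end

end HorizontalLDO
end

theorem corollary4p9 (N n : ℕ) [NeZero n] (A : HorizontalLDO.MultiOp N n)
    (hA : HorizontalLDO.IsLDO A) :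
    ((∃ f : HorizontalLDO.HorOp N n, HorizontalLDO.IsLift A f) ↔
      ∀ (i : Fin N) (j : Fin n),
        HorizontalLDO.IsCharacteristic (HorizontalLDO.compD i j A) 0) ∧
    (HorizontalLDO.IsCharacteristic A 0 →
      ∃ f : HorizontalLDO.HorOp N n, HorizontalLDO.IsLift A f ∧
        ∀ s : ℕ, 2 ≤ s → HorizontalLDO.ComponentZero f s) :=
  ⟨⟨fun ⟨_, hf⟩ i j => hf.isCharacteristic_compD i j,
    fun h => HorizontalLDO.exists_lift hA fun i j => (h i j).mem_chiKer⟩,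
    fun h => HorizontalLDO.exists_short_lift hA h.mem_chiKer⟩
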